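/- There is an absolute constant $c>0$ such that the three lower bounds below hold for every finite field $\mathbb F$ and every integer $t\ge 2$. Model. In the $t$-party number-in-hand blackboard model, player $i$ holds $x_i\in X_i$, and the players write bits on a shared blackboard, where at each moment the contents of the blackboard and the shared randomness determine who writes the next bit, that bit may also depend on the writer's input, and at the end all players agree on an output in $\{-1,1\}$. For a partial function $G\colon X_1\times\cdots\times X_t\to\{-1,1,*\}$, $R_{1/3}(G)$ denotes the least cost (number of bits written in the worst case over all inputs and all outcomes of the shared randomness) of a protocol which on every input $x$ with $G(x)\neq *$ outputs $G(x)$ with probability at least $2/3$; on inputs with $G(x)=*$ its behaviour is arbitrary. Below, player $i$ holds a matrix $M_i$, and $\log$ is the binary logarithm. (a) Rank. For all integers $n,m,R,r$ with $\min\{n,m\}\ge R>r\ge 0$, let $\mathrm{RANK}_{r,R}^{\mathbb F,n,m,t}(M_1,\ldots,M_t)$, for $M_i\in\mathbb F^{n\times m}$, be $-1$ if $\operatorname{rk}(\sum_i M_i)=r$, $1$ if $\operatorname{rk}(\sum_i M_i)=R$, and $*$ otherwise. Then $$R_{1/3}(\mathrm{RANK}_{r,R}^{\mathbb F,n,m,t})\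 \ge\ c\,\bigl(t+t\,r^2\log|\mathbb F|\bigr).$$ (b) Determinant. For all distinct $a,b\in\mathbb F$ and all integers $n\ge 2$, let $\mathrm{DET}_{a,b}^{\mathbb F,n,t}(M_1,\ldots,M_t)$, for $M_i\in\mathbb F^{n\times n}$, be $-1$ if $\det(\sum_i M_i)=a$, $1$ if $\det(\sum_i M_i)=b$, and $*$ otherwise. Then $$R_{1/3}(\mathrm{DET}_{a,b}^{\mathbb F,n,t})\ \ge\ c\,t\,n^2\log|\mathbb F|.$$ (c) Rank versus determinant. For all $a\in\mathbb F\setminus\{0\}$ and all integers $n>r\ge 0$, let $\mathrm{RANKDET}_{r,a}^{\mathbb F,n,t}(M_1,\ldots,M_t)$, for $M_i\in\mathbb F^{n\times n}$, be $-1$ if $\operatorname{rk}(\sum_i M_i)=r$, $1$ if $\det(\sum_i M_i)=a$, and $*$ otherwise. Then $$R_{1/3}(\mathrm{RANKDET}_{r,a}^{\mathbb F,n,t})\ \ge\ c\,\bigl(t+t\,r^2\log|\mathbb F|\bigr).$$ -/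

import Mathlib

/-! Randomized communication complexity in the number-in-hand blackboard model. A partial Boolean
function with domain type `α` is a map `α → Option ℤˣ`: the two elements of `ℤˣ` are the values
`-1` and `1`, and `none` is the value `*` (inputs on which a protocol may behave arbitrarily). -/

universe u

namespace Blackboard

/-- A deterministic `t`-party number-in-hand blackboard protocol, where player `i` holds an element
of `X i`. It is a finite tree whose nodes are the possible contents of the blackboard: these contents
determine either the common output of all the players (`leaf`), or which player `i` writes the
next bit (`node`); that bit is a function of the input of player `i`. -/
inductive Protocol {t : ℕ} (X : Fin t → Type u) : Type u
  | leaf (out : ℤˣ) : Protocol X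
  | node (i : Fin t) (bit : X i → Bool) (next : Bool → Protocol X) : Protocol X

namespace Protocol

variable {t : ℕ} {X : Fin t → Type u}

/-- The output of the protocol on input `x`. -/
def output : Protocol X → (∀ i, X i) → ℤˣ
  | leaf out, _ => out
  | node i bit next, x => output (next (bit (x i))) x

/-- The number of bits written on the blackboard in the execution on input `x`. -/
def bits : Protocol X → (∀ i, X i) → ℕ
  | leaf _, _ => 0
  | node i bit next, x => bits (next (bit (x i))) x + 1

end Protocol

/-- A randomized (public-coin) protocol: a probability distribution on deterministic protocols.
The shared random string selects the deterministic protocol that the players execute. -/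
abbrev RandProtocol {t : ℕ} (X : Fin t → Type u) : Type u := PMF (Protocol X)

namespace RandProtocol

variable {t : ℕ} {X : Fin t → Type u}

/-- The cost: the number of bits written on the blackboard in the worst-case execution, over all
inputs and all outcomes of the shared randomness (it is `⊤` if these numbers are unbounded). -/
noncomputable def cost (P : RandProtocol X) : ℕ∞ :=
  ⨆ p ∈ P.support, ⨆ x : ∀ i, X i, (p.bits x : ℕ∞)

/-- The probability that the output on input `x` is `v`. -/
noncomputable def prob (P : RandProtocol X) (x : ∀ i, X i) (v : ℤˣ) : ℝ :=
  ((P.map fun p => p.output x) v).toReal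

/-- `P` is an `ε`-error protocol for `G`: on every input in the domain of `G`, the output is
correct with probability at least `1 - ε`. -/
def Computes (P : RandProtocol X) (G : (∀ i, X i) → Option ℤˣ) (ε : ℝ) : Prop :=
  ∀ (x : ∀ i, X i) (v : ℤˣ), G x = some v → 1 - ε ≤ P.prob x v

end RandProtocol

/-- The `ε`-error randomized communication complexity of `G`: the least cost of a randomized
protocol that computes `G` with error at most `ε`. -/
noncomputable def randCC {t : ℕ} {X : Fin t → Type u} (ε : ℝ)
    (G : (∀ i, X i) → Option ℤˣ) : ℕ :=
  sInf {c : ℕ | ∃ P : RandProtocol X, P.cost ≤ c ∧ P.Computes G ε}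

/-- A fixed list of questions to the players can be asked one after the other. -/
theorem exists_protocol_of_list {t : ℕ} {X : Fin t → Type u}
    (L : List ((i : Fin t) × (X i → Bool))) (g : List Bool → ℤˣ) :
    ∃ p : Protocol X, ∀ x, p.bits x = L.length ∧
      p.output x = g (L.map fun q => q.2 (x q.1)) := by
  induction L generalizing g with
  | nil => exact ⟨.leaf (g []), fun x => ⟨rfl, rfl⟩⟩
  | cons q L ih =>
    choose p hp using fun b : Bool => ih (fun l => g (b :: l))
    refine ⟨.node q.1 q.2 p, fun x => ⟨?_, ?_⟩⟩
    · simp [Protocol.bits, (hp _ x).1]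
    · simp [Protocol.output, (hp _ x).2]

/-- For finite input sets the minimum in the definition of `randCC` is over a nonempty set: the
players can announce their inputs. -/
theorem randCC_set_nonempty {t : ℕ} {X : Fin t → Type u} [∀ i, Finite (X i)] {ε : ℝ} (hε : 0 ≤ ε)
    (G : (∀ i, X i) → Option ℤˣ) :
    {c : ℕ | ∃ P : RandProtocol X, P.cost ≤ c ∧ P.Computes G ε}.Nonempty := by
  classical
  have : ∀ i, Fintype (X i) := fun i => Fintype.ofFinite _
  let L : List ((i : Fin t) × (X i → Bool)) :=
    (Finset.univ : Finset ((i : Fin t) × X i)).toList.map fun a => ⟨a.1, fun y => decide (y = a.2)⟩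
  let ans : (∀ i, X i) → List Bool := fun x => L.map fun q => q.2 (x q.1)
  have hinj : Function.Injective ans := by
    intro x y hxy
    funext i
    have h := List.map_inj_left.1 hxy ⟨i, fun z => decide (z = x i)⟩
      (List.mem_map.2 ⟨⟨i, x i⟩, by simp, rfl⟩)
    have h' : y i = x i := by simpa using h
    exact h'.symm
  obtain ⟨p, hp⟩ := exists_protocol_of_list L
    (fun l => if h : ∃ x, ans x = l then (G h.choose).getD 1 else 1)
  refine ⟨L.length, PMF.pure p, ?_, ?_⟩
  · refine iSup₂_le fun q hq => iSup_le fun x => ?_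
    have hqp : q = p := by simpa using hq
    rw [hqp, (hp x).1]
  · intro x v hv
    have hex : ∃ x', ans x' = ans x := ⟨x, rfl⟩
    have hout : p.output x = v := by
      rw [(hp x).2]
      change (if h : ∃ x', ans x' = ans x then (G h.choose).getD 1 else 1) = v
      rw [dif_pos hex, hinj hex.choose_spec, hv]
      rfl
    simp [RandProtocol.prob, PMF.pure_map, hout, hε]

/-- The `t`-party problem `(x₁, …, x_t) ↦ f (x₁ + ⋯ + x_t)`. -/
def sumProblem {A : Type u} [AddCommMonoid A] (f : A → Option ℤˣ) (t : ℕ) :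
    (Fin t → A) → Option ℤˣ :=
  fun x => f (∑ i, x i)

/-- The value is `-1` on matrices of rank `r`, `1` on matrices of rank `R`, and `*` otherwise. -/
noncomputable def rankFn (F : Type u) [Field F] (n m r R : ℕ)
    (M : Matrix (Fin n) (Fin m) F) : Option ℤˣ :=
  if M.rank = r then some (-1) else if M.rank = R then some 1 else none

open Classical in
/-- The value is `-1` on matrices of determinant `a`, `1` on matrices of determinant `b`, and `*`
otherwise. -/
noncomputable def detFn (F : Type u) [Field F] (n : ℕ) (a b : F)
    (M : Matrix (Fin n) (Fin n) F) : Option ℤˣ :=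
  if M.det = a then some (-1) else if M.det = b then some 1 else none

open Classical in
/-- The value is `-1` on matrices of rank `r`, `1` on matrices of determinant `a`, and `*`
otherwise. -/
noncomputable def rankDetFn (F : Type u) [Field F] (n r : ℕ) (a : F)
    (M : Matrix (Fin n) (Fin n) F) : Option ℤˣ :=
  if M.rank = r then some (-1) else if M.det = a then some 1 else none

/-- The `t`-party matrix rank problem. -/
noncomputable def rankProblem (F : Type u) [Field F] (n m r R t : ℕ) :
    (Fin t → Matrix (Fin n) (Fin m) F) → Option ℤˣ :=
  sumProblem (rankFn F n m r R) t

/-- The `t`-party determinant problem. -/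
noncomputable def detProblem (F : Type u) [Field F] (n : ℕ) (a b : F) (t : ℕ) :
    (Fin t → Matrix (Fin n) (Fin n) F) → Option ℤˣ :=
  sumProblem (detFn F n a b) t

/-- The `t`-party rank versus determinant problem. -/
noncomputable def rankDetProblem (F : Type u) [Field F] (n r : ℕ) (a : F) (t : ℕ) :
    (Fin t → Matrix (Fin n) (Fin n) F) → Option ℤˣ :=
  sumProblem (rankDetFn F n r a) t

end Blackboard

/-! The proof is a discrepancy argument with a signed test function `ψ` on matrices, evaluated at
the sum of the inputs. Suppose `ψ` has `ℓ¹` norm `O(1)` and constant correlation with every bounded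
function that respects the partial function. A protocol of cost `C` then yields a deterministic one
correlated with `ψ` (`exists_protocol_of_test`). Some pair of cyclically adjacent players writes at
most `2C/t` bits on `|ψ|`-average, so by Markov the output can be replaced by zero when the pair
exceeds `l` bits (`Protocol.abs_sum_mul_output_le`). With the other inputs fixed, what remains is a
signed combination of at most `2 ^ l` rectangles. A rectangle sees little of `ψ (a + b)` if the
Fourier transform of `ψ` is uniformly small (`abs_sum_rectangle_le`). With `l` about `log (1/δ)`,
where `δ` bounds the Fourier transform, this gives `C ≥ Ω(t log (1/δ))`. With `l = 0` only `∑ ψ = 0`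
is needed, and the summand `t` results.

The function `ψ` is a combination of uniform laws on orbits of `SL n × SL n`, which preserve rank
and determinant. At a frequency `Y` of rank `s < n`, vanishing is governed by moments: the chance
that `E * B` kills an `s`-dimensional space is a polynomial of degree `s` in `q ^ (n - rank E)`, up
to a factor independent of `E`. So all frequencies of rank at most `J` vanish once the weights
annihilate polynomials of degree at most `J` (`sum_orbitFourier_eq_zero`). At higher rank every
single orbit has a small coefficient, by averaging over unipotent shifts (`norm_orbitFourier_le`).

For rank `r` against determinant `a ≠ 0`, the orbits have ranks `r - 4j` with `j ≤ J = r / 8`,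
together with one orbit of determinant `a`. The weights extrapolate from the nodes `q ^ (n - r +
4j)` to the node `1` of full rank. As the nodes grow geometrically, nearly all weight sits at `j =
0` (`exists_extrapolation_weights`), so the auxiliary ranks do not spoil the correlation. For two
nonzero determinants both orbits have full rank and all moments cancel at once. -/

namespace Blackboard

open Finset

/-! ### Protocol bookkeeping, local reductions and resampling of coordinates. -/

namespace Protocol

/-- The number of bits written by player `k` in the execution on input `x`. -/
def bitsOf {t : ℕ} {X : Fin t → Type u} (k : Fin t) : Protocol X → (∀ i, X i) → ℕ
  | leaf _, _ => 0
  | node i bit next, x => bitsOf k (next (bit (x i))) x + if i = k then 1 else 0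

theorem sum_bitsOf {t : ℕ} {X : Fin t → Type u} (p : Protocol X) (x : ∀ i, X i) :
    ∑ k, p.bitsOf k x = p.bits x := by
  induction p with
  | leaf out => simp [bitsOf, bits]
  | node i bit next ih => simp [bitsOf, bits, sum_add_distrib, ih]

/-- The protocol in which the players first apply the maps `e i` to their inputs. -/
def comap {t : ℕ} {X Y : Fin t → Type u} (e : ∀ i, Y i → X i) : Protocol X → Protocol Y
  | leaf out => leaf out
  | node i bit next => node i (fun y => bit (e i y)) fun b => comap e (next b)

theorem output_comap {t : ℕ} {X Y : Fin t → Type u} (e : ∀ i, Y i → X i) (p : Protocol X)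
    (y : ∀ i, Y i) : (p.comap e).output y = p.output fun i => e i (y i) := by
  induction p with
  | leaf out => rfl
  | node i bit next ih => simp [comap, output, ih]

theorem bits_comap {t : ℕ} {X Y : Fin t → Type u} (e : ∀ i, Y i → X i) (p : Protocol X)
    (y : ∀ i, Y i) : (p.comap e).bits y = p.bits fun i => e i (y i) := by
  induction p with
  | leaf out => rfl
  | node i bit next ih => simp [comap, bits, ih]

end Protocol

theorem exists_cost_le_randCC {t : ℕ} {X : Fin t → Type u} [∀ i, Finite (X i)] {ε : ℝ}
    (hε : 0 ≤ ε) (G : (∀ i, X i) → Option ℤˣ) :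
    ∃ P : RandProtocol X, P.cost ≤ randCC ε G ∧ P.Computes G ε :=
  Nat.sInf_mem (randCC_set_nonempty hε G)

/-- A reduction in which the players locally transform their inputs. -/
theorem randCC_le_of_reduction {t : ℕ} {X Y : Fin t → Type u} [∀ i, Finite (X i)] {ε : ℝ}
    (hε : 0 ≤ ε) (G : (∀ i, X i) → Option ℤˣ) (H : (∀ i, Y i) → Option ℤˣ) (e : ∀ i, Y i → X i)
    (h : ∀ y v, H y = some v → G (fun i => e i (y i)) = some v) :
    randCC ε H ≤ randCC ε G := by
  obtain ⟨P, hc, hP⟩ := exists_cost_le_randCC hε G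
  refine Nat.sInf_le ⟨P.map (Protocol.comap e), ?_, ?_⟩
  · refine le_trans (iSup₂_le fun q hq => iSup_le fun y => ?_) hc
    obtain ⟨p, hp, rfl⟩ := (PMF.mem_support_map_iff _ _ _).1 hq
    rw [Protocol.bits_comap]
    exact le_iSup₂_of_le p hp (le_iSup (fun x => (p.bits x : ℕ∞)) _)
  · intro y v hv
    have := hP _ v (h y v hv)
    unfold RandProtocol.prob at this ⊢
    rw [PMF.map_comp]
    convert this using 4
    ext p
    exact congrArg _ (Protocol.output_comap e p y)

/-- Resampling a coordinate. -/
theorem sum_sum_update {ι A : Type*} [Fintype ι] [DecidableEq ι] [Fintype A] (i : ι)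
    (F : (ι → A) → ℝ) :
    ∑ z, ∑ a, F (Function.update z i a) = Fintype.card A * ∑ x, F x := by
  have hinv : Function.Involutive
      (fun y : (ι → A) × A => (Function.update y.1 i y.2, y.1 i)) := by
    rintro ⟨z, a⟩
    simp
  have h := Equiv.sum_comp hinv.toPerm fun y : (ι → A) × A => F y.1
  rw [Fintype.sum_prod_type, Fintype.sum_prod_type] at h
  simpa [mul_sum] using h

theorem sum_update {ι A : Type*} [Fintype ι] [DecidableEq ι] [AddCommGroup A] (z : ι → A) (i : ι)
    (a : A) : ∑ k, Function.update z i a k = a + (∑ k, z k - z i) := by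
  rw [← add_sum_erase _ _ (mem_univ i), ← add_sum_erase (a := i) univ z (mem_univ i)]
  simp only [Function.update_self, add_sub_cancel_left]
  congr 1
  exact sum_congr rfl fun k hk => Function.update_of_ne (ne_of_mem_erase hk) _ _

theorem sum_comp_sum {A : Type*} [AddCommGroup A] [Fintype A] {t : ℕ} (ht : 0 < t) (g : A → ℝ) :
    ∑ x : Fin t → A, g (∑ i, x i) = (Fintype.card A : ℝ) ^ (t - 1) * ∑ m, g m := by
  have hN : (Fintype.card A : ℝ) ≠ 0 := by simp
  have h := sum_sum_update (A := A) (⟨0, ht⟩ : Fin t) fun x => g (∑ i, x i)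
  simp only [sum_update] at h
  have h2 : ∀ c : A, ∑ a, g (a + c) = ∑ a, g a := fun c => Equiv.sum_comp (Equiv.addRight c) g
  simp only [h2, sum_const, card_univ, Fintype.card_fun, Fintype.card_fin, nsmul_eq_mul] at h
  apply mul_left_cancel₀ hN
  rw [← h, ← mul_assoc, ← pow_succ', Nat.sub_add_cancel ht]
  push_cast
  ring

/-! ### Truncating the output by the number of bits of two players. -/

namespace Protocol

variable {t : ℕ} {A : Type u}

/-- The output as a real number, replaced by `0` when players `i` and `j` together write more than
`l` bits. -/
def truncOutput (i j : Fin t) (l : ℕ) (p : Protocol fun _ : Fin t => A) (x : Fin t → A) : ℝ :=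
  if p.bitsOf i x + p.bitsOf j x ≤ l then ((p.output x : ℤ) : ℝ) else 0

theorem abs_unit_real (v : ℤˣ) : |((v : ℤ) : ℝ)| = 1 := by
  rcases Int.units_eq_one_or v with h | h <;> simp [h]

theorem truncOutput_node_other {i j k : Fin t} (hi : k ≠ i) (hj : k ≠ j) (l : ℕ) (bit : A → Bool)
    (next : Bool → Protocol fun _ : Fin t => A) (x : Fin t → A) :
    truncOutput i j l (node k bit next) x = truncOutput i j l (next (bit (x k))) x := by
  simp [truncOutput, bitsOf, output, hi, hj]

theorem truncOutput_node_left {i j : Fin t} (hij : i ≠ j) (l : ℕ) (bit : A → Bool)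
    (next : Bool → Protocol fun _ : Fin t => A) (x : Fin t → A) :
    truncOutput i j (l + 1) (node i bit next) x = truncOutput i j l (next (bit (x i))) x := by
  simp only [truncOutput, bitsOf, output, hij, if_true, if_false]
  congr 1
  exact propext ⟨fun h => by omega, fun h => by omega⟩

theorem truncOutput_node_right {i j : Fin t} (hij : i ≠ j) (l : ℕ) (bit : A → Bool)
    (next : Bool → Protocol fun _ : Fin t => A) (x : Fin t → A) :
    truncOutput i j (l + 1) (node j bit next) x = truncOutput i j l (next (bit (x j))) x := by
  simp only [truncOutput, bitsOf, output, hij.symm, if_true, if_false]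
  congr 1
  exact propext ⟨fun h => by omega, fun h => by omega⟩

theorem truncOutput_zero_node {i j k : Fin t} (h : k = i ∨ k = j) (bit : A → Bool)
    (next : Bool → Protocol fun _ : Fin t => A) (x : Fin t → A) :
    truncOutput i j 0 (node k bit next) x = 0 := by
  rcases h with rfl | rfl <;> simp [truncOutput, bitsOf]

/-- With no bits allowed to the pair, the bits of the other players are fixed by `z`. The truncated
output is therefore a constant in `{-1, 0, 1}` as `a` and `b` vary. -/
theorem abs_sum_truncOutput_zero [Fintype A] (i j : Fin t)
    (p : Protocol fun _ : Fin t => A) (φ : A → A → ℝ) (z : Fin t → A) :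
    |∑ a, ∑ b, φ a b * p.truncOutput i j 0 (Function.update (Function.update z i a) j b)|
      ≤ |∑ a, ∑ b, φ a b| := by
  induction p with
  | leaf out =>
    simp [truncOutput, bitsOf, output, ← sum_mul, abs_mul, abs_unit_real]
  | node k bit next ih =>
    by_cases h : k = i ∨ k = j
    · simp [truncOutput_zero_node h]
    · push Not at h
      simpa [truncOutput_node_other h.1 h.2, h.1, h.2] using ih (bit (z k))

/-- A bit of player `i` splits `S`, a bit of player `j` splits `T`, and either lowers the budget `l`
by one; bits of other players are determined by `z` and are free. The induction needs arbitrary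
rectangles `S × T` for this reason. -/
theorem abs_sum_truncOutput (i j : Fin t) (hij : i ≠ j) (p : Protocol fun _ : Fin t => A)
    (φ : A → A → ℝ) {D : ℝ} (hD : ∀ S T : Finset A, |∑ a ∈ S, ∑ b ∈ T, φ a b| ≤ D)
    (z : Fin t → A) (l : ℕ) (S T : Finset A) :
    |∑ a ∈ S, ∑ b ∈ T,
        φ a b * p.truncOutput i j l (Function.update (Function.update z i a) j b)|
      ≤ 2 ^ l * D := by
  have hD0 : 0 ≤ D := (abs_nonneg _).trans (hD ∅ ∅)
  induction p generalizing l S T with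
  | leaf out =>
    simp only [truncOutput, bitsOf, output, add_zero, zero_le, if_true, ← sum_mul, abs_mul,
      abs_unit_real, mul_one]
    exact (hD S T).trans (le_mul_of_one_le_left hD0 (one_le_pow₀ one_le_two))
  | node k bit next ih =>
    by_cases h : k = i ∨ k = j
    · cases l with
      | zero => simpa [truncOutput_zero_node h] using hD0
      | succ l =>
        rcases h with rfl | rfl
        · simp only [truncOutput_node_left hij]
          rw [← sum_filter_add_sum_filter_not S (fun a => bit a = true)]
          have h1 := ih true l (S.filter fun a => bit a = true) T
          have h2 := ih false l (S.filter fun a => ¬ bit a = true) T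
          refine (abs_add_le _ _).trans ?_
          rw [pow_succ, mul_assoc, mul_comm 2 D, ← mul_assoc, mul_two]
          refine add_le_add (le_of_eq_of_le ?_ h1) (le_of_eq_of_le ?_ h2)
          · congr 1
            refine sum_congr rfl fun a ha => sum_congr rfl fun b _ => ?_
            simp [hij, (mem_filter.1 ha).2]
          · congr 1
            refine sum_congr rfl fun a ha => sum_congr rfl fun b _ => ?_
            simp [hij, Bool.eq_false_of_not_eq_true (mem_filter.1 ha).2]
        · simp only [truncOutput_node_right hij]
          simp only [← fun f : A → ℝ => sum_filter_add_sum_filter_not T (fun a => bit a = true) f]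
          have h1 := ih true l S (T.filter fun a => bit a = true)
          have h2 := ih false l S (T.filter fun a => ¬ bit a = true)
          rw [sum_add_distrib]
          refine (abs_add_le _ _).trans ?_
          rw [pow_succ, mul_assoc, mul_comm 2 D, ← mul_assoc, mul_two]
          refine add_le_add (le_of_eq_of_le ?_ h1) (le_of_eq_of_le ?_ h2)
          · congr 1
            refine sum_congr rfl fun a _ => sum_congr rfl fun b hb => ?_
            simp [(mem_filter.1 hb).2]
          · congr 1
            refine sum_congr rfl fun a _ => sum_congr rfl fun b hb => ?_
            simp [Bool.eq_false_of_not_eq_true (mem_filter.1 hb).2]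
    · push Not at h
      simpa [truncOutput_node_other h.1 h.2, h.1, h.2] using ih (bit (z k)) l S T

end Protocol

end Blackboard

namespace Blackboard

open Finset

/-! ### Averaging over adjacent pairs of players. -/

namespace Protocol

variable {t : ℕ} {A : Type u}

theorem abs_output_sub_truncOutput_le (i j : Fin t) (l : ℕ) (p : Protocol fun _ : Fin t => A)
    (x : Fin t → A) :
    |((p.output x : ℤ) : ℝ) - p.truncOutput i j l x| ≤
      ((p.bitsOf i x : ℝ) + p.bitsOf j x) / (l + 1) := by
  unfold truncOutput
  split_ifs with h
  · simp only [sub_self, abs_zero]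
    positivity
  · rw [sub_zero, abs_unit_real, le_div_iff₀ (by positivity)]
    push Not at h
    have : ((l + 1 : ℕ) : ℝ) ≤ ((p.bitsOf i x + p.bitsOf j x : ℕ) : ℝ) := by exact_mod_cast h
    push_cast at this
    linarith

/-- Resampling coordinates `i` and `j` turns the `t`-party sum into an average of two-party sums in
which the rest of the input only contributes a shift. -/
theorem sum_truncOutput_eq [AddCommGroup A] [Fintype A] {i j : Fin t} (hij : i ≠ j) (l : ℕ)
    (p : Protocol fun _ : Fin t => A) (ψ : A → ℝ) :
    (Fintype.card A : ℝ) ^ 2 * ∑ x : Fin t → A, ψ (∑ k, x k) * p.truncOutput i j l x =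
      ∑ z : Fin t → A, ∑ a, ∑ b, ψ (a + b + (∑ k, z k - z i - z j)) *
        p.truncOutput i j l (Function.update (Function.update z i a) j b) := by
  rw [sq, mul_assoc, ← sum_sum_update j, ← sum_sum_update i]
  refine sum_congr rfl fun z _ => sum_congr rfl fun a _ => sum_congr rfl fun b _ => ?_
  rw [sum_update, sum_update, Function.update_of_ne hij.symm]
  congr 2
  abel

/-- A pair of players that writes at most an average number of bits can be cut off. -/
theorem abs_sum_mul_output_le [AddCommGroup A] [Fintype A] (ht : 2 ≤ t)
    (p : Protocol fun _ : Fin t => A) {C : ℕ} (hC : ∀ x, p.bits x ≤ C) (ψ : A → ℝ) {L β : ℝ}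
    (hL : ∑ m, |ψ m| ≤ L) (l : ℕ)
    (hβ : ∀ (i j : Fin t) (_ : i ≠ j) (z : Fin t → A) (c : A),
      |∑ a, ∑ b, ψ (a + b + c) *
        p.truncOutput i j l (Function.update (Function.update z i a) j b)| ≤
        Fintype.card A * β) :
    |∑ x : Fin t → A, ψ (∑ k, x k) * ((p.output x : ℤ) : ℝ)| ≤
      (Fintype.card A : ℝ) ^ (t - 1) * (2 * C * L / (t * (l + 1)) + β) := by
  have hN : 0 < (Fintype.card A : ℝ) := by exact_mod_cast Fintype.card_pos
  have ht0 : (0 : ℝ) < t := by exact_mod_cast (by omega : 0 < t)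
  set W : ℝ := (Fintype.card A : ℝ) ^ (t - 1) * L with hW
  have hW' : ∑ x : Fin t → A, |ψ (∑ k, x k)| ≤ W := by
    rw [sum_comp_sum (by omega) fun m => |ψ m|]
    exact mul_le_mul_of_nonneg_left hL (by positivity)
  let B : Fin t → ℝ := fun i => ∑ x : Fin t → A, |ψ (∑ k, x k)| * p.bitsOf i x
  have hB : ∑ i, B i ≤ C * W := by
    calc ∑ i, B i = ∑ x : Fin t → A, |ψ (∑ k, x k)| * p.bits x := by
          simp only [B]
          rw [sum_comm]
          refine sum_congr rfl fun x _ => ?_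
          rw [← mul_sum, ← sum_bitsOf]
          push_cast
          rfl
      _ ≤ ∑ x : Fin t → A, |ψ (∑ k, x k)| * C := by
          gcongr with x
          exact hC x
      _ ≤ C * W := by
          rw [← sum_mul, mul_comm]
          gcongr
  have hne : ∀ i : Fin t, i ≠ finRotate t i := by
    obtain ⟨s, rfl⟩ : ∃ s, t = s + 2 := ⟨t - 2, by omega⟩
    intro i h
    rw [finRotate_apply] at h
    simp at h
  -- Among the `t` cyclic pairs each player occurs twice, so the pair sums total at most `2 * (C *
  -- W)`.
  obtain ⟨i, -, hi⟩ : ∃ i ∈ (univ : Finset (Fin t)), B i + B (finRotate t i) ≤ 2 * (C * W) / t := by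
    refine exists_le_of_sum_le ⟨⟨0, by omega⟩, mem_univ _⟩ ?_
    rw [sum_add_distrib, Equiv.sum_comp (finRotate t) B, sum_const, card_univ, Fintype.card_fin,
      nsmul_eq_mul, mul_div_cancel₀ _ ht0.ne']
    linarith
  set j := finRotate t i
  have h1 : |∑ x : Fin t → A, ψ (∑ k, x k) * p.truncOutput i j l x| ≤
      (Fintype.card A : ℝ) ^ (t - 1) * β := by
    have h := sum_truncOutput_eq (hne i) l p ψ
    have h2 : (Fintype.card A : ℝ) ^ 2 *
        |∑ x : Fin t → A, ψ (∑ k, x k) * p.truncOutput i j l x| ≤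
        (Fintype.card A : ℝ) ^ 2 * ((Fintype.card A : ℝ) ^ (t - 1) * β) := by
      rw [← abs_of_pos (pow_pos hN 2), ← abs_mul, h, abs_of_pos (pow_pos hN 2)]
      refine (abs_sum_le_sum_abs _ _).trans ?_
      refine (sum_le_sum fun z _ => hβ i j (hne i) z _).trans (le_of_eq ?_)
      rw [sum_const, card_univ, Fintype.card_fun, Fintype.card_fin, nsmul_eq_mul]
      push_cast
      obtain ⟨s, rfl⟩ : ∃ s, t = s + 1 := ⟨t - 1, by omega⟩
      simp only [Nat.add_sub_cancel]
      ring
    exact le_of_mul_le_mul_left h2 (pow_pos hN 2)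
  -- Markov's inequality: the truncation changes the output only where the pair writes at least `l +
  -- 1` bits.
  have h2 : |∑ x : Fin t → A, ψ (∑ k, x k) *
      (((p.output x : ℤ) : ℝ) - p.truncOutput i j l x)| ≤ 2 * (C * W) / t / (l + 1) := by
    calc _ ≤ ∑ x : Fin t → A, |ψ (∑ k, x k)| *
          (((p.bitsOf i x : ℝ) + p.bitsOf j x) / (l + 1)) := by
          refine (abs_sum_le_sum_abs _ _).trans (sum_le_sum fun x _ => ?_)
          rw [abs_mul]
          gcongr
          exact abs_output_sub_truncOutput_le i j l p x
      _ = (B i + B j) / (l + 1) := by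
          simp only [B]
          rw [← sum_add_distrib, sum_div]
          refine sum_congr rfl fun x _ => ?_
          ring
      _ ≤ _ := by gcongr
  calc |∑ x : Fin t → A, ψ (∑ k, x k) * ((p.output x : ℤ) : ℝ)|
      = |∑ x : Fin t → A, ψ (∑ k, x k) * (((p.output x : ℤ) : ℝ) - p.truncOutput i j l x) +
          ∑ x : Fin t → A, ψ (∑ k, x k) * p.truncOutput i j l x| := by
        rw [← sum_add_distrib]
        congr 1
        exact sum_congr rfl fun x _ => by ring
    _ ≤ _ := (abs_add_le _ _).trans (add_le_add h2 h1)
    _ = _ := by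
        rw [hW]
        field_simp

end Protocol

/-! ### From randomized protocols to lower bounds via a test function. -/

/-- The law of the outputs of a randomized protocol. -/
noncomputable def RandProtocol.outputLaw {t : ℕ} {X : Fin t → Type u} (P : RandProtocol X) :
    PMF ((∀ i, X i) → ℤˣ) :=
  P.map fun p x => p.output x

/-- Protocols form an infinite type, but there are only finitely many output functions; passing to
their law makes every expectation a finite sum. -/
theorem RandProtocol.prob_eq_sum {t : ℕ} {X : Fin t → Type u} [Fintype (∀ i, X i)]
    [DecidableEq (∀ i, X i)] (P : RandProtocol X) (x : ∀ i, X i) (v : ℤˣ) :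
    P.prob x v = ∑ o : (∀ i, X i) → ℤˣ, if v = o x then (P.outputLaw o).toReal else 0 := by
  have h : (P.map fun p => p.output x) = P.outputLaw.map fun o => o x := by
    unfold outputLaw
    rw [PMF.map_comp]
    rfl
  unfold prob
  rw [h, PMF.map_apply, tsum_fintype, ENNReal.toReal_sum]
  · refine sum_congr rfl fun o _ => ?_
    split_ifs <;> simp
  · intro o _
    split_ifs
    · exact PMF.apply_ne_top _ _
    · exact ENNReal.zero_ne_top

theorem sum_toReal_eq_one {α : Type*} [Fintype α] (Q : PMF α) : ∑ o, (Q o).toReal = 1 := by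
  rw [← ENNReal.toReal_sum fun o _ => PMF.apply_ne_top _ _, ← tsum_fintype (L := .unconditional α), PMF.tsum_coe]
  rfl

theorem RandProtocol.expected_output {t : ℕ} {X : Fin t → Type u} [Fintype (∀ i, X i)]
    [DecidableEq (∀ i, X i)] (P : RandProtocol X) (x : ∀ i, X i) (v : ℤˣ) :
    ((v : ℤ) : ℝ) * ∑ o : (∀ i, X i) → ℤˣ, (P.outputLaw o).toReal * ((o x : ℤ) : ℝ) =
      2 * P.prob x v - 1 := by
  rw [P.prob_eq_sum, ← sum_toReal_eq_one P.outputLaw, mul_sum, mul_sum, ← sum_sub_distrib]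
  refine sum_congr rfl fun o _ => ?_
  rcases Int.units_eq_one_or v with h | h <;> rcases Int.units_eq_one_or (o x) with h' | h' <;>
    simp [h, h'] <;> ring

/-- The discrepancy method for sums of the inputs of `t` players. -/
theorem exists_protocol_of_test {A : Type u} [AddCommGroup A] [Fintype A] (f : A → Option ℤˣ)
    {t : ℕ} (ht : 2 ≤ t) (ψ : A → ℝ) {κ : ℝ}
    (hκ : ∀ h : A → ℝ, (∀ m, |h m| ≤ 1) → (∀ m v, f m = some v → 1 / 3 ≤ ((v : ℤ) : ℝ) * h m) →
      κ ≤ ∑ m, ψ m * h m) :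
    ∃ p : Protocol fun _ : Fin t => A,
      (∀ x, p.bits x ≤ randCC (1 / 3) (sumProblem f t)) ∧
      (Fintype.card A : ℝ) ^ (t - 1) * κ ≤
        ∑ x : Fin t → A, ψ (∑ k, x k) * ((p.output x : ℤ) : ℝ) := by
  classical
  obtain ⟨P, hc, hP⟩ := exists_cost_le_randCC (ε := 1 / 3) (by norm_num) (sumProblem f t)
  have hN : 0 < (Fintype.card A : ℝ) := by exact_mod_cast Fintype.card_pos
  set Q := P.outputLaw with hQ
  let E : (Fin t → A) → ℝ := fun x => ∑ o, (Q o).toReal * ((o x : ℤ) : ℝ)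
  have hE1 : ∀ x, |E x| ≤ 1 := fun x => by
    refine (abs_sum_le_sum_abs _ _).trans ?_
    rw [← sum_toReal_eq_one Q]
    refine sum_le_sum fun o _ => ?_
    rw [abs_mul, Protocol.abs_unit_real, mul_one, abs_of_nonneg ENNReal.toReal_nonneg]
  have hE2 : ∀ x v, f (∑ k, x k) = some v → 1 / 3 ≤ ((v : ℤ) : ℝ) * E x := fun x v hv => by
    have := hP x v hv
    rw [P.expected_output]
    linarith
  have hE : (Fintype.card A : ℝ) ^ (t - 1) * κ ≤ ∑ x : Fin t → A, ψ (∑ k, x k) * E x := by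
    let i : Fin t := ⟨0, by omega⟩
    -- The mean of the expected output over all inputs with sum `m`. It inherits the bound and the
    -- correctness of `E`, so `hκ` applies to it.
    let h : A → ℝ := fun m => (∑ z : Fin t → A,
      E (Function.update z i (m - (∑ k, z k - z i)))) / (Fintype.card A : ℝ) ^ t
    have hcard : (Fintype.card (Fin t → A) : ℝ) = (Fintype.card A : ℝ) ^ t := by
      rw [Fintype.card_fun, Fintype.card_fin]
      push_cast
      rfl
    have h1 := hκ h ?_ ?_
    · have h2 := sum_sum_update i fun x : Fin t → A => ψ (∑ k, x k) * E x
      simp only [sum_update] at h2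
      have h3 : ∀ z : Fin t → A, ∑ a, ψ (a + (∑ k, z k - z i)) * E (Function.update z i a) =
          ∑ m, ψ m * E (Function.update z i (m - (∑ k, z k - z i))) := fun z => by
        rw [← Equiv.sum_comp (Equiv.addRight (∑ k, z k - z i))
          fun m => ψ m * E (Function.update z i (m - (∑ k, z k - z i)))]
        simp
      simp only [h3] at h2
      rw [sum_comm] at h2
      simp only [← mul_sum] at h2
      have h4 : ∑ m, ψ m * h m =
          (Fintype.card A * ∑ x : Fin t → A, ψ (∑ k, x k) * E x) / (Fintype.card A : ℝ) ^ t := by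
        rw [← h2, sum_div]
        exact sum_congr rfl fun m _ => by simp only [h, mul_div_assoc]
      rw [h4, le_div_iff₀ (by positivity)] at h1
      refine le_of_mul_le_mul_left (le_of_eq_of_le ?_ h1) hN
      obtain ⟨s, rfl⟩ : ∃ s, t = s + 1 := ⟨t - 1, by omega⟩
      simp only [Nat.add_sub_cancel]
      ring
    · intro m
      simp only [h]
      rw [abs_div, abs_of_pos (pow_pos hN t), div_le_one (by positivity), ← hcard]
      refine (abs_sum_le_sum_abs _ _).trans ((sum_le_sum fun z _ => hE1 _).trans (by simp))
    · intro m v hv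
      simp only [h]
      rw [← mul_div_assoc, le_div_iff₀ (by positivity), ← hcard, mul_sum]
      refine le_trans (by simp [mul_comm]) (sum_le_sum (f := fun _ => (1 / 3 : ℝ)) fun z _ => hE2 _ v ?_)
      rw [sum_update]
      simpa using hv
  -- Some output function of positive probability correlates with `ψ` at least as well as the
  -- average does.
  have hex : ∃ o, Q o ≠ 0 ∧
      (Fintype.card A : ℝ) ^ (t - 1) * κ ≤ ∑ x : Fin t → A, ψ (∑ k, x k) * ((o x : ℤ) : ℝ) := by
    by_contra! hcon
    refine absurd hE (not_le.2 ?_)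
    have h5 : ∑ x : Fin t → A, ψ (∑ k, x k) * E x =
        ∑ o, (Q o).toReal * ∑ x : Fin t → A, ψ (∑ k, x k) * ((o x : ℤ) : ℝ) := by
      simp only [E, mul_sum]
      rw [sum_comm]
      exact sum_congr rfl fun o _ => sum_congr rfl fun x _ => by ring
    rw [h5, ← one_mul ((Fintype.card A : ℝ) ^ (t - 1) * κ), ← sum_toReal_eq_one Q, sum_mul]
    obtain ⟨o, ho⟩ := Q.support_nonempty
    have hpos : ∀ o, Q o ≠ 0 → 0 < (Q o).toReal := fun o ho =>
      ENNReal.toReal_pos ho (PMF.apply_ne_top _ _)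
    refine sum_lt_sum (fun o _ => ?_) ⟨o, mem_univ _, ?_⟩
    · by_cases h0 : Q o = 0
      · simp [h0]
      · exact mul_le_mul_of_nonneg_left (hcon o h0).le (hpos o h0).le
    · exact mul_lt_mul_of_pos_left (hcon o ho) (hpos o ho)
  obtain ⟨o, ho, hbig⟩ := hex
  obtain ⟨p, hp, rfl⟩ := (PMF.mem_support_map_iff _ _ _).1 ho
  refine ⟨p, fun x => ?_, hbig⟩
  have : (p.bits x : ℕ∞) ≤ P.cost :=
    le_iSup₂_of_le p hp (le_iSup (fun x => (p.bits x : ℕ∞)) x)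
  exact_mod_cast this.trans hc

/-- The players must communicate about one bit each. -/
theorem le_randCC_of_sum_eq_zero {A : Type u} [AddCommGroup A] [Fintype A] (f : A → Option ℤˣ)
    {t : ℕ} (ht : 2 ≤ t) (ψ : A → ℝ) {κ L : ℝ}
    (hκ : ∀ h : A → ℝ, (∀ m, |h m| ≤ 1) → (∀ m v, f m = some v → 1 / 3 ≤ ((v : ℤ) : ℝ) * h m) →
      κ ≤ ∑ m, ψ m * h m)
    (hL : ∑ m, |ψ m| ≤ L) (h0 : ∑ m, ψ m = 0) :
    κ * t ≤ 2 * L * randCC (1 / 3) (sumProblem f t) := by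
  obtain ⟨p, hp, hbig⟩ := exists_protocol_of_test f ht ψ hκ
  have hN : 0 < (Fintype.card A : ℝ) := by exact_mod_cast Fintype.card_pos
  have ht0 : (0 : ℝ) < t := by exact_mod_cast (by omega : 0 < t)
  have h := p.abs_sum_mul_output_le ht hp ψ hL 0 (β := 0) ?_
  · have h1 := le_of_mul_le_mul_left ((hbig.trans (le_abs_self _)).trans h) (pow_pos hN (t - 1))
    rw [add_zero, Nat.cast_zero, zero_add, mul_one, le_div_iff₀ ht0] at h1
    linarith
  · intro i j hij z c
    refine (Protocol.abs_sum_truncOutput_zero i j p (fun a b => ψ (a + b + c)) z).trans ?_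
    have h2 : ∀ c : A, ∑ b, ψ (b + c) = 0 := fun c =>
      (Equiv.sum_comp (Equiv.addRight c) ψ).trans h0
    have h3 : ∀ a : A, ∑ b, ψ (a + b + c) = 0 := fun a => by
      rw [← h2 (a + c)]
      exact sum_congr rfl fun b _ => congrArg ψ (by abel)
    simp [h3]

/-- The lower bound from a test function with small discrepancy. -/
theorem le_randCC_of_discrepancy {A : Type u} [AddCommGroup A] [Fintype A] (f : A → Option ℤˣ)
    {t : ℕ} (ht : 2 ≤ t) (ψ : A → ℝ) {κ L δ : ℝ}
    (hκ : ∀ h : A → ℝ, (∀ m, |h m| ≤ 1) → (∀ m v, f m = some v → 1 / 3 ≤ ((v : ℤ) : ℝ) * h m) →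
      κ ≤ ∑ m, ψ m * h m)
    (hL : ∑ m, |ψ m| ≤ L)
    (hδ : ∀ S T : Finset A, |∑ a ∈ S, ∑ b ∈ T, ψ (a + b)| ≤ Fintype.card A * δ) (l : ℕ) :
    κ ≤ 2 * randCC (1 / 3) (sumProblem f t) * L / (t * (l + 1)) + 2 ^ l * δ := by
  classical
  obtain ⟨p, hp, hbig⟩ := exists_protocol_of_test f ht ψ hκ
  have hN : 0 < (Fintype.card A : ℝ) := by exact_mod_cast Fintype.card_pos
  refine le_of_mul_le_mul_left ((hbig.trans (le_abs_self _)).trans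
    (p.abs_sum_mul_output_le ht hp ψ hL l fun i j hij z c => ?_)) (pow_pos hN (t - 1))
  refine (Protocol.abs_sum_truncOutput i j hij p (fun a b => ψ (a + b + c)) (fun S T => ?_) z l
    univ univ).trans (le_of_eq (mul_left_comm _ _ _))
  -- The shift `c` coming from the other players is absorbed into the second side of the rectangle.
  refine le_of_eq_of_le ?_ (hδ S (T.map (Equiv.addRight c).toEmbedding))
  simp [add_assoc]

end Blackboard

namespace Blackboard

open Finset

/-! ### Fourier bound for rectangle discrepancy. -/

section Fourier

variable {A Y : Type*} [AddCommGroup A] [Fintype A] [DecidableEq A] [Fintype Y]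

/-- Parseval for an indicator function. Only the orthogonality relation `he` is used, so `Y` need
not be identified with the dual group. -/
theorem sum_norm_sq_charSum (e : Y → AddChar A ℂ)
    (he : ∀ a, ∑ y, e y a = if a = 0 then (Fintype.card A : ℂ) else 0) (S : Finset A) :
    ∑ y, ‖∑ a ∈ S, e y a‖ ^ 2 = Fintype.card A * #S := by
  have h : ∑ y, (∑ a ∈ S, e y a) * (starRingEnd ℂ) (∑ a ∈ S, e y a) =
      (Fintype.card A : ℂ) * #S := by
    simp only [map_sum, sum_mul_sum, ← AddChar.map_neg_eq_conj, ← AddChar.map_add_eq_mul]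
    rw [sum_comm]
    simp_rw [sum_comm (s := (univ : Finset Y)), he, ← sub_eq_add_neg, sub_eq_zero]
    simp [mul_comm]
  simp only [Complex.mul_conj'] at h
  exact_mod_cast h

/-- A function with small Fourier transform has small discrepancy on rectangles. -/
theorem abs_sum_rectangle_le (e : Y → AddChar A ℂ)
    (he : ∀ a, ∑ y, e y a = if a = 0 then (Fintype.card A : ℂ) else 0) (ψ : A → ℝ) {δ : ℝ}
    (hδ : ∀ y, ‖∑ m, (ψ m : ℂ) * e y m‖ ≤ δ) (S T : Finset A) :
    |∑ a ∈ S, ∑ b ∈ T, ψ (a + b)| ≤ Fintype.card A * δ := by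
  have hN : 0 < (Fintype.card A : ℝ) := by exact_mod_cast Fintype.card_pos
  have hY : Nonempty Y := by
    by_contra hY
    rw [not_nonempty_iff] at hY
    have := he 0
    simp [eq_comm] at this
  have hδ0 : 0 ≤ δ := (norm_nonneg _).trans (hδ hY.some)
  -- Fourier inversion: summing over `y` keeps exactly the terms with `m = a + b`.
  have h1 : ((Fintype.card A : ℝ) : ℂ) * ((∑ a ∈ S, ∑ b ∈ T, ψ (a + b) : ℝ) : ℂ) =
      ∑ y, (∑ m, (ψ m : ℂ) * e y m) * (starRingEnd ℂ) (∑ a ∈ S, e y a) *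
        (starRingEnd ℂ) (∑ b ∈ T, e y b) := by
    have h : ∀ y, (∑ m, (ψ m : ℂ) * e y m) * (starRingEnd ℂ) (∑ a ∈ S, e y a) *
        (starRingEnd ℂ) (∑ b ∈ T, e y b) =
        ∑ a ∈ S, ∑ b ∈ T, ∑ m, (ψ m : ℂ) * e y (m + (-a + -b)) := fun y => by
      simp only [map_sum, ← AddChar.map_neg_eq_conj]
      rw [mul_assoc, sum_mul_sum, mul_comm, sum_mul]
      refine sum_congr rfl fun a _ => ?_
      rw [sum_mul]
      refine sum_congr rfl fun b _ => ?_
      rw [mul_sum]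
      refine sum_congr rfl fun m _ => ?_
      rw [AddChar.map_add_eq_mul, AddChar.map_add_eq_mul]
      ring
    simp only [h]
    rw [sum_comm (s := (univ : Finset Y))]
    push_cast
    rw [mul_sum]
    refine sum_congr rfl fun a _ => ?_
    rw [sum_comm (s := (univ : Finset Y)), mul_sum]
    refine sum_congr rfl fun b _ => ?_
    rw [sum_comm (s := (univ : Finset Y))]
    simp only [← mul_sum, he]
    rw [sum_eq_single (a + b)]
    · rw [if_pos (show a + b + (-a + -b) = 0 by abel), mul_comm]
    · intro m _ hm
      rw [if_neg, mul_zero]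
      intro h
      exact hm (by rw [← sub_eq_zero, ← h]; abel)
    · simp
  -- The product of the two character sums is bounded by the mean of their squares, in place of
  -- Cauchy–Schwarz; `S` and `T` are bounded by all of `A` in any case.
  have h2 : (Fintype.card A : ℝ) * |∑ a ∈ S, ∑ b ∈ T, ψ (a + b)| ≤
      ∑ y, δ * ((‖∑ a ∈ S, e y a‖ ^ 2 + ‖∑ b ∈ T, e y b‖ ^ 2) / 2) := by
    have h3 := congrArg norm h1
    rw [norm_mul, Complex.norm_real, Complex.norm_real, Real.norm_eq_abs, Real.norm_eq_abs,
      abs_of_pos hN] at h3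
    rw [h3]
    refine (norm_sum_le _ _).trans (sum_le_sum fun y _ => ?_)
    rw [norm_mul, norm_mul, RCLike.norm_conj, RCLike.norm_conj, mul_assoc]
    refine mul_le_mul (hδ y) ?_ (by positivity) hδ0
    linarith [two_mul_le_add_sq ‖∑ a ∈ S, e y a‖ ‖∑ b ∈ T, e y b‖]
  rw [← mul_sum, ← sum_div, sum_add_distrib, sum_norm_sq_charSum e he,
    sum_norm_sq_charSum e he] at h2
  have hS : (#S : ℝ) ≤ Fintype.card A := by exact_mod_cast card_le_univ S
  have hT : (#T : ℝ) ≤ Fintype.card A := by exact_mod_cast card_le_univ T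
  refine le_of_mul_le_mul_left (h2.trans ?_) hN
  calc δ * ((Fintype.card A * #S + Fintype.card A * #T) / 2)
      ≤ δ * ((Fintype.card A * Fintype.card A + Fintype.card A * Fintype.card A : ℝ) / 2) := by
        gcongr
    _ = _ := by ring

end Fourier

/-! ### Additive characters of matrix spaces. -/

section MatrixCharacters

variable {F : Type*} [Field F] {m n : Type*} [Fintype m] [Fintype n]

/-- The additive character `M ↦ χ (tr (Y M))`. -/
def traceChar (χ : AddChar F ℂ) (Y : Matrix m n F) : AddChar (Matrix n m F) ℂ where
  toFun M := χ (Y * M).trace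
  map_zero_eq_one' := by simp
  map_add_eq_mul' M M' := by simp [Matrix.mul_add, AddChar.map_add_eq_mul]

theorem traceChar_apply (χ : AddChar F ℂ) (Y : Matrix m n F) (M : Matrix n m F) :
    traceChar χ Y M = χ (Y * M).trace := rfl

theorem exists_trace_mul_eq [DecidableEq m] [DecidableEq n] {M : Matrix n m F} (hM : M ≠ 0)
    (c : F) : ∃ Y : Matrix m n F, (Y * M).trace = c := by
  obtain ⟨i, j, hij⟩ : ∃ i j, M i j ≠ 0 := by
    by_contra! h
    exact hM (by ext i j; exact h i j)
  refine ⟨Matrix.single j i (c / M i j), ?_⟩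
  rw [Matrix.trace_single_mul]
  simp [div_mul_cancel₀ _ hij]

theorem sum_char_trace [Fintype F] [DecidableEq F] [DecidableEq m] [DecidableEq n]
    {χ : AddChar F ℂ} (hχ : χ ≠ 1) (M : Matrix n m F) :
    ∑ Y : Matrix m n F, χ (Y * M).trace =
      if M = 0 then (Fintype.card (Matrix m n F) : ℂ) else 0 := by
  split_ifs with h
  · simp [h]
  · have h1 : ∀ Y : Matrix m n F, χ (Y * M).trace = traceChar χ M Y := fun Y => by
      rw [traceChar_apply, Matrix.trace_mul_comm]
    simp only [h1]
    refine AddChar.sum_eq_zero_of_ne_one fun h2 => hχ ?_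
    ext c
    obtain ⟨Y, hY⟩ := exists_trace_mul_eq h c
    have := DFunLike.congr_fun h2 Y
    rw [← h1, hY] at this
    simpa using this

theorem exists_nontrivial_char (F : Type*) [Field F] [Fintype F] : ∃ χ : AddChar F ℂ, χ ≠ 1 := by
  obtain ⟨χ, hχ⟩ := AddChar.exists_apply_ne_zero.2 (one_ne_zero (α := F))
  exact ⟨χ, fun h => hχ (by simp [h])⟩

end MatrixCharacters

end Blackboard

namespace Blackboard

open Finset Matrix

/-! ### Rank inequalities and factorizations. -/

section RankFacts

variable {F : Type*} [Field F]

theorem linearIndependent_col_of_rank {n s : ℕ} {U : Matrix (Fin n) (Fin s) F} (hU : U.rank = s) :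
    LinearIndependent F U.col := by
  rw [linearIndependent_iff_card_eq_finrank_span, Set.finrank, ← rank_eq_finrank_span_cols, hU,
    Fintype.card_fin]

theorem rank_eq_of_linearIndependent_col {n s : ℕ} {U : Matrix (Fin n) (Fin s) F}
    (hU : LinearIndependent F U.col) : U.rank = s := by
  rw [rank_eq_finrank_span_cols]
  rw [linearIndependent_iff_card_eq_finrank_span, Set.finrank, Fintype.card_fin] at hU
  exact hU.symm

theorem exists_rank_factorization {n m : ℕ} (M : Matrix (Fin n) (Fin m) F) :
    ∃ (U : Matrix (Fin n) (Fin M.rank) F) (V : Matrix (Fin M.rank) (Fin m) F),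
      M = U * V ∧ U.rank = M.rank ∧ V.rank = M.rank := by
  let W := Submodule.span F (Set.range M.col)
  have hW : Module.finrank F W = M.rank := (rank_eq_finrank_span_cols M).symm
  let b := Module.finBasisOfFinrankEq F W hW
  let c : Fin m → W := fun j => ⟨M.col j, Submodule.subset_span ⟨j, rfl⟩⟩
  let U : Matrix (Fin n) (Fin M.rank) F := Matrix.of fun i k => (b k : Fin n → F) i
  let V : Matrix (Fin M.rank) (Fin m) F := Matrix.of fun k j => b.repr (c j) k
  have hM : M = U * V := by
    ext i j
    have h := congrArg (fun w : W => (w : Fin n → F) i) (b.sum_repr (c j))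
    simp only [AddSubmonoidClass.coe_finsetSum, SetLike.val_smul, Finset.sum_apply,
      Pi.smul_apply, smul_eq_mul] at h
    rw [mul_apply]
    refine Eq.trans h.symm (sum_congr rfl fun k _ => mul_comm _ _)
  have h1 : M.rank ≤ U.rank := by
    conv_lhs => rw [hM]
    exact rank_mul_le_left U V
  have h2 : M.rank ≤ V.rank := by
    conv_lhs => rw [hM]
    exact rank_mul_le_right U V
  exact ⟨U, V, hM, le_antisymm (rank_le_width U) h1, le_antisymm (rank_le_height V) h2⟩

/-- Sylvester's inequality: apply rank–nullity to `A` restricted to the range of `B`, whose kernel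
embeds into that of `A`. -/
theorem rank_add_rank_le_rank_mul_add {l m n : ℕ} (A : Matrix (Fin l) (Fin m) F)
    (B : Matrix (Fin m) (Fin n) F) : A.rank + B.rank ≤ (A * B).rank + m := by
  have h1 := LinearMap.finrank_range_add_finrank_ker A.mulVecLin
  have h2 := LinearMap.finrank_range_add_finrank_ker
    (A.mulVecLin.domRestrict (LinearMap.range B.mulVecLin))
  rw [LinearMap.range_domRestrict, ← LinearMap.range_comp, ← mulVecLin_mul,
    LinearMap.ker_domRestrict] at h2
  have h3 : Module.finrank F (Submodule.comap (LinearMap.range B.mulVecLin).subtype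
      (LinearMap.ker A.mulVecLin)) ≤ Module.finrank F (LinearMap.ker A.mulVecLin) := by
    refine LinearMap.finrank_le_finrank_of_injective
      (f := ((LinearMap.range B.mulVecLin).subtype.restrict fun x hx => hx)) ?_
    intro x y h
    exact Subtype.ext (Subtype.ext (congrArg
      (fun z : LinearMap.ker A.mulVecLin => (z : Fin m → F)) h))
  rw [Module.finrank_fin_fun] at h1
  simp only [Matrix.rank]
  omega

theorem finrank_ker_mulVecLin {m n : ℕ} (A : Matrix (Fin m) (Fin n) F) :
    Module.finrank F (LinearMap.ker A.mulVecLin) = n - A.rank := by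
  have h1 := LinearMap.finrank_range_add_finrank_ker A.mulVecLin
  rw [Module.finrank_fin_fun] at h1
  simp only [Matrix.rank]
  omega

/-- `P` is a projection onto the kernel of `Q`. -/
theorem exists_mul_eq_zero_rank {s n : ℕ} (Q : Matrix (Fin s) (Fin n) F) :
    ∃ P : Matrix (Fin n) (Fin n) F, Q * P = 0 ∧ P.rank = n - Q.rank := by
  let K := LinearMap.ker Q.mulVecLin
  obtain ⟨g, hg⟩ := K.subtype.exists_leftInverse_of_injective K.ker_subtype
  have hsurj : Function.Surjective g := fun x => ⟨x, DFunLike.congr_fun hg x⟩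
  refine ⟨LinearMap.toMatrix' (K.subtype ∘ₗ g), ?_, ?_⟩
  · apply (Matrix.toLin' (R := F)).injective
    rw [toLin'_mul, toLin'_toMatrix', map_zero]
    refine LinearMap.ext fun x => ?_
    exact (g _).2
  · rw [← finrank_ker_mulVecLin, Matrix.rank, ← toLin'_apply', toLin'_toMatrix',
      LinearMap.range_comp, LinearMap.range_eq_top.2 hsurj, Submodule.map_top,
      Submodule.range_subtype]

/-- Take `s` independent vectors in the row space of `Y`; the rows of `Q` are coefficient vectors
expressing them through the rows of `Y`. -/
theorem exists_mul_rank_eq {m n s : ℕ} (Y : Matrix (Fin m) (Fin n) F) (hs : s ≤ Y.rank) :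
    ∃ Q : Matrix (Fin s) (Fin m) F, Q.rank = s ∧ (Q * Y).rank = s := by
  rw [← rank_transpose] at hs
  obtain ⟨f, hf⟩ := exists_linearIndependent_of_le_finrank hs
  choose q hq using fun i => (f i).2
  let Q : Matrix (Fin s) (Fin m) F := Matrix.of q
  have hQY : (Q * Y).rank = s := by
    rw [← rank_transpose]
    apply rank_eq_of_linearIndependent_col
    have : (Q * Y)ᵀ.col = fun i => (f i : Fin n → F) := by
      funext i
      rw [← hq i]
      ext j
      simp [Q, mul_apply, vecMul, dotProduct, mul_comm]
    rw [this]
    exact hf.map' (Submodule.subtype _) (Submodule.ker_subtype _)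
  exact ⟨Q, le_antisymm (rank_le_height Q) (hQY.symm.trans_le (rank_mul_le_left Q Y)), hQY⟩

end RankFacts

/-! ### Transitivity of the action of `SL n`. -/

section SLAction

variable {F : Type*} [Field F]

/-- `SL n` acts transitively on families of fewer than `n` linearly independent vectors. -/
theorem exists_specialLinear_map {n s : ℕ} (hs : s < n) {x y : Fin s → Fin n → F}
    (hx : LinearIndependent F x) (hy : LinearIndependent F y) :
    ∃ g : SpecialLinearGroup (Fin n) F, ∀ i, g.1 *ᵥ x i = y i := by
  obtain ⟨g, hg⟩ := Submodule.exists_linearEquiv_restrict_eq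
    (hx.linearCombinationEquiv.symm ≪≫ₗ hy.linearCombinationEquiv)
  have hgx : ∀ i, g (x i) = y i := fun i => by
    have h1 : hx.linearCombinationEquiv (Finsupp.single i 1) = x i := by simp
    have h2 : hy.linearCombinationEquiv (Finsupp.single i 1) = y i := by simp
    rw [← h1, ← hg, LinearEquiv.trans_apply, LinearEquiv.symm_apply_apply, h2]
  have hlt : Submodule.span F (Set.range x) < ⊤ := by
    rw [lt_top_iff_ne_top]
    intro h
    have h1 := linearIndependent_iff_card_eq_finrank_span.1 hx
    rw [Set.finrank, h, finrank_top, Module.finrank_fin_fun, Fintype.card_fin] at h1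
    omega
  obtain ⟨f, hf0, hf⟩ := Submodule.exists_le_ker_of_lt_top _ hlt
  obtain ⟨v, hv⟩ : ∃ v, f v ≠ 0 := by
    by_contra! h
    exact hf0 (LinearMap.ext h)
  let d : F := (LinearMap.det (g : (Fin n → F) →ₗ[F] (Fin n → F)))⁻¹
  have hd : LinearMap.det (g : (Fin n → F) →ₗ[F] (Fin n → F)) ≠ 0 :=
    (LinearEquiv.isUnit_det' g).ne_zero
  -- Since `f` vanishes on all `x i`, the map `y ↦ y + f y • w` fixes them, and its determinant is
  -- `1 + f w`. The multiple `w` of `v` is chosen so that this equals `d`, which corrects the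
  -- determinant of `g` to `1`.
  let h := (g : (Fin n → F) →ₗ[F] (Fin n → F)) ∘ₗ
    LinearMap.transvection f (((d - 1) / f v) • v)
  have hdet : LinearMap.det h = 1 := by
    simp only [h]
    rw [LinearMap.det_comp, LinearMap.transvection.det, map_smul, smul_eq_mul,
      div_mul_cancel₀ _ hv, add_sub_cancel]
    exact mul_inv_cancel₀ hd
  refine ⟨⟨LinearMap.toMatrix' h, by rw [LinearMap.det_toMatrix', hdet]⟩, fun i => ?_⟩
  have hfx : f (x i) = 0 := hf (Submodule.subset_span ⟨i, rfl⟩)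
  change LinearMap.toMatrix' h *ᵥ x i = y i
  rw [← toLin'_apply, toLin'_toMatrix']
  simp [h, LinearMap.transvection.apply, hfx, hgx]

theorem exists_specialLinear_mul_left {n s : ℕ} (hs : s < n) {U U' : Matrix (Fin n) (Fin s) F}
    (hU : U.rank = s) (hU' : U'.rank = s) :
    ∃ g : SpecialLinearGroup (Fin n) F, g.1 * U = U' := by
  obtain ⟨g, hg⟩ := exists_specialLinear_map hs (linearIndependent_col_of_rank hU)
    (linearIndependent_col_of_rank hU')
  refine ⟨g, ?_⟩
  ext i j
  exact congrFun (hg j) i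

theorem exists_specialLinear_mul_right {n s : ℕ} (hs : s < n) {V V' : Matrix (Fin s) (Fin n) F}
    (hV : V.rank = s) (hV' : V'.rank = s) :
    ∃ g : SpecialLinearGroup (Fin n) F, V * g.1 = V' := by
  rw [← rank_transpose] at hV hV'
  obtain ⟨g, hg⟩ := exists_specialLinear_mul_left hs hV hV'
  refine ⟨g.transpose, ?_⟩
  have := congrArg Matrix.transpose hg
  simpa using this

theorem specialLinear_inv_mulVec {n : ℕ} (g : SpecialLinearGroup (Fin n) F) (v : Fin n → F) :
    (g⁻¹).1 *ᵥ (g.1 *ᵥ v) = v := by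
  simp [mulVec_mulVec, adjugate_mul]

theorem specialLinear_mulVec_inv {n : ℕ} (g : SpecialLinearGroup (Fin n) F) (v : Fin n → F) :
    g.1 *ᵥ ((g⁻¹).1 *ᵥ v) = v := by
  simp [mulVec_mulVec, mul_adjugate]

end SLAction

/-! ### Counting elements of `SL n` that satisfy incidence conditions. -/

section Counting

variable {F : Type u} [Field F] [Fintype F]

/-- If `s` exceeds the dimension of `K`, the factor with `i` equal to that dimension is zero. The
real product is thus correct without a condition on `s`, and it is a polynomial in `q ^ finrank K`.
-/
theorem card_linearIndependent_mem {V : Type*} [AddCommGroup V] [Module F V] [Fintype V]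
    (K : Submodule F V) (s : ℕ) :
    (Nat.card {x : Fin s → V // LinearIndependent F x ∧ ∀ j, x j ∈ K} : ℝ) =
      ∏ i ∈ range s, ((Fintype.card F : ℝ) ^ Module.finrank F K - (Fintype.card F : ℝ) ^ i) := by
  have e : {x : Fin s → V // LinearIndependent F x ∧ ∀ j, x j ∈ K} ≃
      {x : Fin s → K // LinearIndependent F x} :=
    { toFun := fun x => ⟨fun j => ⟨x.1 j, x.2.2 j⟩,
        LinearIndependent.of_comp K.subtype x.2.1⟩
      invFun := fun x => ⟨fun j => x.1 j,
        x.2.map' K.subtype K.ker_subtype, fun j => (x.1 j).2⟩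
      left_inv := fun x => rfl
      right_inv := fun x => rfl }
  rw [Nat.card_congr e]
  by_cases hs : s ≤ Module.finrank F K
  · rw [card_linearIndependent hs, ← Fin.prod_univ_eq_prod_range
      (fun i => (Fintype.card F : ℝ) ^ Module.finrank F K - (Fintype.card F : ℝ) ^ i)]
    push_cast
    refine prod_congr rfl fun i _ => ?_
    rw [Nat.cast_sub (Nat.pow_le_pow_right Fintype.card_pos (i.2.le.trans hs))]
    push_cast
    rfl
  · push Not at hs
    rw [prod_eq_zero (mem_range.2 hs) (sub_self _)]
    have : IsEmpty {x : Fin s → K // LinearIndependent F x} := ⟨fun x => by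
      have := x.2.fintype_card_le_finrank
      rw [Fintype.card_fin] at this
      omega⟩
    simp

/-- Double counting of pairs of `g` and an independent family `y` with all `g y j` in `K`. By
transitivity the number of `g` is the same for each `y`; by invertibility the number of `y` is the
same for each `g`. -/
theorem card_filter_mem_submodule [DecidableEq F] {n s : ℕ} (hs : s < n) {x : Fin s → Fin n → F}
    (hx : LinearIndependent F x) (K : Submodule F (Fin n → F))
    [DecidablePred fun g : SpecialLinearGroup (Fin n) F => ∀ j, g.1 *ᵥ x j ∈ K] :
    (#{g : SpecialLinearGroup (Fin n) F | ∀ j, g.1 *ᵥ x j ∈ K} : ℝ) *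
        ∏ i ∈ range s, ((Fintype.card F : ℝ) ^ n - (Fintype.card F : ℝ) ^ i) =
      Fintype.card (SpecialLinearGroup (Fin n) F) *
        ∏ i ∈ range s, ((Fintype.card F : ℝ) ^ Module.finrank F K - (Fintype.card F : ℝ) ^ i) := by
  classical
  have h1 := card_linearIndependent_mem (⊤ : Submodule F (Fin n → F)) s
  simp only [Submodule.mem_top, implies_true, and_true, finrank_top, Module.finrank_fin_fun] at h1
  rw [← h1, ← card_linearIndependent_mem K s]
  rw [Nat.card_eq_fintype_card, Nat.card_eq_fintype_card, Fintype.card_subtype,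
    Fintype.card_subtype]
  have hli : ∀ (g : SpecialLinearGroup (Fin n) F) (y : Fin s → Fin n → F),
      LinearIndependent F (fun j => g.1 *ᵥ y j) ↔ LinearIndependent F y := fun g y => by
    have hinj : Function.Injective g.1.mulVecLin := by
      exact Function.LeftInverse.injective (g := (g⁻¹).1.mulVecLin)
        (specialLinear_inv_mulVec g)
    exact LinearMap.linearIndependent_iff g.1.mulVecLin (LinearMap.ker_eq_bot.2 hinj)
  have key : ∀ y : Fin s → Fin n → F, LinearIndependent F y →
      #{g : SpecialLinearGroup (Fin n) F | ∀ j, g.1 *ᵥ y j ∈ K} =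
        #{g : SpecialLinearGroup (Fin n) F | ∀ j, g.1 *ᵥ x j ∈ K} := fun y hy => by
    obtain ⟨h, hh⟩ := exists_specialLinear_map hs hx hy
    refine card_equiv (Equiv.mulRight h) fun g => ?_
    simp [← mulVec_mulVec, hh]
  have hsum : ∑ y : Fin s → Fin n → F with LinearIndependent F y,
        #{g : SpecialLinearGroup (Fin n) F | ∀ j, g.1 *ᵥ y j ∈ K} =
      ∑ g : SpecialLinearGroup (Fin n) F,
        #{y : Fin s → Fin n → F | LinearIndependent F y ∧ ∀ j, g.1 *ᵥ y j ∈ K} := by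
    simp only [card_filter, ite_and, sum_filter]
    rw [sum_comm' (t' := univ) (s' := fun _ => univ) (by simp)]
    refine sum_congr rfl fun y _ => ?_
    split_ifs <;> simp
  have key2 : ∀ g : SpecialLinearGroup (Fin n) F,
      #{y : Fin s → Fin n → F | LinearIndependent F y ∧ ∀ j, g.1 *ᵥ y j ∈ K} =
        #{y : Fin s → Fin n → F | LinearIndependent F y ∧ ∀ j, y j ∈ K} := fun g => by
    refine card_bij (fun y _ j => g.1 *ᵥ y j) ?_ ?_ ?_
    · intro y hy
      simpa [hli] using hy
    · intro y _ y' _ h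
      funext j
      have := congrArg (fun v => (g⁻¹).1 *ᵥ v) (congrFun h j)
      simpa only [specialLinear_inv_mulVec] using this
    · intro y hy
      refine ⟨fun j => (g⁻¹).1 *ᵥ y j, ?_, ?_⟩
      · simpa only [mem_filter, mem_univ, true_and, hli, specialLinear_mulVec_inv] using hy
      · funext j
        exact specialLinear_mulVec_inv g _
  rw [sum_congr rfl fun y hy => key y (mem_filter.1 hy).2, sum_congr rfl fun g _ => key2 g,
    sum_const, sum_const, card_univ, smul_eq_mul, smul_eq_mul] at hsum
  rw [mul_comm]
  exact_mod_cast hsum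

end Counting

end Blackboard

namespace Blackboard

open Finset Matrix

section Counting

variable {F : Type u} [Field F]

theorem eq_zero_of_rank_eq_zero {m n : ℕ} {M : Matrix (Fin m) (Fin n) F} (h : M.rank = 0) :
    M = 0 := by
  rw [Matrix.rank, Submodule.finrank_eq_zero, LinearMap.range_eq_bot] at h
  exact (Matrix.toLin' (R := F)).injective (h.trans (map_zero _).symm)

theorem rank_specialLinear_mul {m n : ℕ} (B : SpecialLinearGroup (Fin n) F)
    (E : Matrix (Fin m) (Fin n) F) : (E * B.1).rank = E.rank :=
  rank_mul_eq_left_of_isUnit_det _ _ (by rw [B.2]; exact isUnit_one)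

variable [Fintype F]

theorem prod_pow_sub_pow_pos {n s : ℕ} (hs : s ≤ n) :
    0 < ∏ i ∈ range s, ((Fintype.card F : ℝ) ^ n - (Fintype.card F : ℝ) ^ i) := by
  have hq : (1 : ℝ) < Fintype.card F := by exact_mod_cast Fintype.one_lt_card (α := F)
  refine prod_pos fun i hi => sub_pos.2 (pow_lt_pow_right₀ hq ?_)
  have := mem_range.1 hi
  omega

variable [DecidableEq F]

theorem card_mul_mul_eq_zero {m n s : ℕ} (hs : s < n) (E : Matrix (Fin m) (Fin n) F)
    {U : Matrix (Fin n) (Fin s) F} (hU : U.rank = s) :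
    (#{B : SpecialLinearGroup (Fin n) F | E * B.1 * U = 0} : ℝ) *
        ∏ i ∈ range s, ((Fintype.card F : ℝ) ^ n - (Fintype.card F : ℝ) ^ i) =
      Fintype.card (SpecialLinearGroup (Fin n) F) *
        ∏ i ∈ range s, ((Fintype.card F : ℝ) ^ (n - E.rank) - (Fintype.card F : ℝ) ^ i) := by
  classical
  rw [← finrank_ker_mulVecLin, ← card_filter_mem_submodule hs (linearIndependent_col_of_rank hU)
    (LinearMap.ker E.mulVecLin)]
  congr 3
  ext B
  simp only [mem_filter, mem_univ, true_and, LinearMap.mem_ker, mulVecLin_apply, mulVec_mulVec]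
  constructor
  · intro h j
    ext i
    exact congrFun (congrFun h i) j
  · intro h
    ext i j
    exact congrFun (h j) i

/-- After transposing, the exact count has factors `(q ^ (n - ρ) - q ^ i) / (q ^ n - q ^ i)` with `ρ
= Z.rank`, each at most `q ^ (-ρ)` when `s ≤ n - ρ`. For larger `s` the count is zero. -/
theorem card_mul_mul_eq_zero_le {m n s : ℕ} (hs : s < n) {L : Matrix (Fin s) (Fin n) F}
    (hL : L.rank = s) (Z : Matrix (Fin n) (Fin m) F) :
    (#{A : SpecialLinearGroup (Fin n) F | L * A.1 * Z = 0} : ℝ) ≤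
      Fintype.card (SpecialLinearGroup (Fin n) F) / (Fintype.card F : ℝ) ^ (s * Z.rank) := by
  have hq : (1 : ℝ) < Fintype.card F := by exact_mod_cast Fintype.one_lt_card (α := F)
  have hcard : #{A : SpecialLinearGroup (Fin n) F | L * A.1 * Z = 0} =
      #{B : SpecialLinearGroup (Fin n) F | Zᵀ * B.1 * Lᵀ = 0} := by
    refine card_bij' (fun A _ => A.transpose) (fun B _ => B.transpose) ?_ ?_ ?_ ?_
    · intro A hA
      simp only [mem_filter, mem_univ, true_and] at hA ⊢
      have := congrArg Matrix.transpose hA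
      simpa [Matrix.mul_assoc] using this
    · intro A hA
      simp only [mem_filter, mem_univ, true_and] at hA ⊢
      have := congrArg Matrix.transpose hA
      simpa [Matrix.mul_assoc] using this
    · intro A _
      ext
      simp
    · intro A _
      ext
      simp
  have h := card_mul_mul_eq_zero hs Zᵀ (U := Lᵀ) (by rw [rank_transpose, hL])
  rw [rank_transpose, ← hcard] at h
  have hZ : Z.rank ≤ n := rank_le_height Z
  have hpos := prod_pow_sub_pow_pos (F := F) hs.le
  rw [le_div_iff₀ (by positivity), ← mul_le_mul_iff_left₀ hpos, mul_right_comm, h, mul_assoc]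
  refine mul_le_mul_of_nonneg_left ?_ (by positivity)
  by_cases hsZ : s ≤ n - Z.rank
  · rw [mul_comm s, pow_mul, show ((Fintype.card F : ℝ) ^ Z.rank) ^ s =
      ∏ _i ∈ range s, (Fintype.card F : ℝ) ^ Z.rank by rw [prod_const, card_range],
      ← prod_mul_distrib]
    refine prod_le_prod (fun i hi => ?_) fun i hi => ?_
    · have := mem_range.1 hi
      refine mul_nonneg (sub_nonneg.2 (pow_le_pow_right₀ hq.le (by omega))) (by positivity)
    · rw [sub_mul, ← pow_add, Nat.sub_add_cancel hZ]
      refine sub_le_sub_left ?_ _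
      exact le_mul_of_one_le_right (by positivity) (one_le_pow₀ hq.le)
  · push Not at hsZ
    rw [prod_eq_zero (mem_range.2 hsZ) (sub_self _), zero_mul]
    exact hpos.le

end Counting

/-! ### Fourier coefficients of `SL n × SL n` orbits. -/

section OrbitFourier

variable {F : Type u} [Field F] [Fintype F] [DecidableEq F]

/-- The Fourier transform at `Y` of the orbit of `E` under `SL n × SL n`, with multiplicities. -/
noncomputable def orbitFourier {n : ℕ} (χ : AddChar F ℂ) (E Y : Matrix (Fin n) (Fin n) F) : ℂ :=
  ∑ A : SpecialLinearGroup (Fin n) F, ∑ B : SpecialLinearGroup (Fin n) F,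
    χ (Y * (A.1 * E * B.1)).trace

theorem orbitFourier_mul_right {n : ℕ} (χ : AddChar F ℂ) (E Y : Matrix (Fin n) (Fin n) F)
    (C : SpecialLinearGroup (Fin n) F) : orbitFourier χ E (Y * C.1) = orbitFourier χ E Y := by
  unfold orbitFourier
  refine Fintype.sum_equiv (Equiv.mulLeft C) _ _ fun A => ?_
  simp [Matrix.mul_assoc]

/-- Since `Q * P = 0`, every `1 + P * W * Q` has determinant `1` and may be absorbed into `B`. This
multiplies the summand by a character of `W`, and averaging over `W` kills every pair `A, B` for
which that character is nontrivial. -/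
theorem norm_orbitFourier_le {n s : ℕ} {χ : AddChar F ℂ} (hχ : χ ≠ 1)
    (E Y P : Matrix (Fin n) (Fin n) F) (Q : Matrix (Fin s) (Fin n) F) (hQP : Q * P = 0) :
    ‖orbitFourier χ E Y‖ ≤ ∑ B : SpecialLinearGroup (Fin n) F,
      (#{A : SpecialLinearGroup (Fin n) F | Q * Y * A.1 * (E * B.1 * P) = 0} : ℝ) := by
  have hshift : ∀ W : Matrix (Fin n) (Fin s) F, orbitFourier χ E Y =
      ∑ A : SpecialLinearGroup (Fin n) F, ∑ B : SpecialLinearGroup (Fin n) F,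
        χ (Y * (A.1 * E * B.1)).trace * χ (W * (Q * Y * A.1 * (E * B.1 * P))).trace := fun W => by
    let g : SpecialLinearGroup (Fin n) F := ⟨1 + P * W * Q, by
      rw [det_one_add_mul_comm, ← Matrix.mul_assoc, hQP, Matrix.zero_mul, add_zero, det_one]⟩
    unfold orbitFourier
    refine sum_congr rfl fun A _ => Eq.symm ?_
    refine Fintype.sum_equiv (Equiv.mulRight g) _ _ fun B => ?_
    rw [← AddChar.map_add_eq_mul]
    congr 1
    have h1 : (W * (Q * Y * A.1 * (E * B.1 * P))).trace =
        (Y * (A.1 * E * B.1) * (P * W * Q)).trace := by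
      rw [show W * (Q * Y * A.1 * (E * B.1 * P)) = (W * Q) * (Y * A.1 * E * B.1 * P) by
        simp only [Matrix.mul_assoc], trace_mul_comm]
      simp only [Matrix.mul_assoc]
    rw [h1, ← trace_add]
    congr 1
    change _ = Y * (A.1 * E * (B.1 * (1 + P * W * Q)))
    simp only [Matrix.mul_add, Matrix.mul_one, Matrix.mul_assoc]
  have hcard : 0 < (Fintype.card (Matrix (Fin n) (Fin s) F) : ℝ) := by
    exact_mod_cast Fintype.card_pos
  have hsum : (Fintype.card (Matrix (Fin n) (Fin s) F) : ℂ) * orbitFourier χ E Y =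
      ∑ A : SpecialLinearGroup (Fin n) F, ∑ B : SpecialLinearGroup (Fin n) F,
        χ (Y * (A.1 * E * B.1)).trace * (if Q * Y * A.1 * (E * B.1 * P) = 0 then
          (Fintype.card (Matrix (Fin n) (Fin s) F) : ℂ) else 0) := by
    rw [← nsmul_eq_mul, ← card_univ, ← sum_const]
    rw [sum_congr rfl fun W _ => hshift W, sum_comm]
    refine sum_congr rfl fun A _ => ?_
    rw [sum_comm]
    refine sum_congr rfl fun B _ => ?_
    rw [← mul_sum, sum_char_trace hχ, card_univ]
  have hnorm := congrArg norm hsum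
  rw [norm_mul, Complex.norm_natCast] at hnorm
  refine le_of_mul_le_mul_left (hnorm.trans_le ?_) hcard
  rw [mul_sum, sum_comm]
  refine (norm_sum_le _ _).trans (sum_le_sum fun B _ => (norm_sum_le _ _).trans (le_of_eq ?_))
  rw [card_filter, Nat.cast_sum, mul_sum]
  refine sum_congr rfl fun A _ => ?_
  rw [norm_mul, AddChar.norm_apply, one_mul]
  split_ifs <;> simp

/-- With `Q` of rank `s` and `P` a projection onto its kernel, Sylvester's inequality gives `E * B *
P` rank at least `k - s` for every `B`. A random `A` then satisfies the vanishing condition with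
probability at most `q ^ (-s (k - s))`. -/
theorem norm_orbitFourier_le_of_rank {n s k : ℕ} {χ : AddChar F ℂ} (hχ : χ ≠ 1) (hs : s < n)
    {E Y : Matrix (Fin n) (Fin n) F} (hY : s ≤ Y.rank) (hE : k ≤ E.rank) :
    ‖orbitFourier χ E Y‖ ≤ (Fintype.card (SpecialLinearGroup (Fin n) F) : ℝ) ^ 2 /
      (Fintype.card F : ℝ) ^ (s * (k - s)) := by
  have hq : (1 : ℝ) < Fintype.card F := by exact_mod_cast Fintype.one_lt_card (α := F)
  obtain ⟨Q, hQ, hQY⟩ := exists_mul_rank_eq Y hY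
  obtain ⟨P, hQP, hP⟩ := exists_mul_eq_zero_rank Q
  refine (norm_orbitFourier_le hχ E Y P Q hQP).trans ?_
  rw [sq, mul_div_assoc, ← card_univ, ← nsmul_eq_mul, ← sum_const]
  refine sum_le_sum fun B _ => (card_mul_mul_eq_zero_le hs hQY _).trans ?_
  rw [card_univ]
  refine div_le_div_of_nonneg_left (by positivity) (by positivity) ?_
  refine pow_le_pow_right₀ hq.le (Nat.mul_le_mul_left s ?_)
  have h := rank_add_rank_le_rank_mul_add (E * B.1) P
  rw [rank_specialLinear_mul, hP, hQ] at h
  omega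

/-- The previous bound is void for `s = k = 1`. Here the `B` with `E * B * P = 0` are separated out:
they are rare, because a single row combination `L * E` already has to be killed by `B * P`. -/
theorem norm_orbitFourier_le_of_ne_zero {n : ℕ} {χ : AddChar F ℂ} (hχ : χ ≠ 1) (hn : 2 ≤ n)
    {E Y : Matrix (Fin n) (Fin n) F} (hY : 1 ≤ Y.rank) (hE : 1 ≤ E.rank) :
    ‖orbitFourier χ E Y‖ ≤ 2 * (Fintype.card (SpecialLinearGroup (Fin n) F) : ℝ) ^ 2 /
      Fintype.card F := by
  have hq : (1 : ℝ) < Fintype.card F := by exact_mod_cast Fintype.one_lt_card (α := F)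
  obtain ⟨Q, hQ, hQY⟩ := exists_mul_rank_eq Y hY
  obtain ⟨P, hQP, hP⟩ := exists_mul_eq_zero_rank Q
  obtain ⟨L, -, hLE⟩ := exists_mul_rank_eq E hE
  refine (norm_orbitFourier_le hχ E Y P Q hQP).trans ?_
  set N := (Fintype.card (SpecialLinearGroup (Fin n) F) : ℝ) with hN
  have h1 : ∀ B : SpecialLinearGroup (Fin n) F,
      (#{A : SpecialLinearGroup (Fin n) F | Q * Y * A.1 * (E * B.1 * P) = 0} : ℝ) ≤
        N / Fintype.card F + if L * E * B.1 * P = 0 then N else 0 := fun B => by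
    by_cases h : E * B.1 * P = 0
    · rw [if_pos (by rw [Matrix.mul_assoc L, Matrix.mul_assoc L, h, Matrix.mul_zero])]
      refine le_add_of_nonneg_of_le (by positivity) ?_
      rw [hN]
      exact Nat.cast_le.2 (card_le_univ _)
    · refine le_add_of_le_of_nonneg ((card_mul_mul_eq_zero_le (by omega) hQY _).trans ?_)
        (by split_ifs <;> positivity)
      refine div_le_div_of_nonneg_left (by positivity) (by positivity) ?_
      refine le_self_pow₀ hq.le ?_
      rw [one_mul]
      exact fun h0 => h (eq_zero_of_rank_eq_zero h0)
  refine (sum_le_sum fun B _ => h1 B).trans ?_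
  rw [sum_add_distrib, ← sum_filter, sum_const, sum_const, card_univ, nsmul_eq_mul, nsmul_eq_mul,
    ← hN]
  have h2 : (#{B : SpecialLinearGroup (Fin n) F | L * E * B.1 * P = 0} : ℝ) ≤
      N / Fintype.card F := by
    refine (card_mul_mul_eq_zero_le (by omega) hLE P).trans ?_
    refine div_le_div_of_nonneg_left (by positivity) (by positivity) ?_
    refine le_self_pow₀ hq.le ?_
    rw [one_mul, hP, hQ]
    omega
  calc N * (N / Fintype.card F) + #{B : SpecialLinearGroup (Fin n) F | L * E * B.1 * P = 0} * N
      ≤ N * (N / Fintype.card F) + N / Fintype.card F * N := by gcongr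
    _ = _ := by ring

/-- Orthogonality in `V` converts Fourier coefficients into a count depending on `E` only through
its rank when `U` has full column rank `s < n`; this links them to the moments. -/
theorem sum_orbitFourier_mul {n s : ℕ} {χ : AddChar F ℂ} (hχ : χ ≠ 1)
    (E : Matrix (Fin n) (Fin n) F) (U : Matrix (Fin n) (Fin s) F) :
    ∑ V : Matrix (Fin s) (Fin n) F, orbitFourier χ E (U * V) =
      Fintype.card (SpecialLinearGroup (Fin n) F) * Fintype.card (Matrix (Fin s) (Fin n) F) *
        (#{B : SpecialLinearGroup (Fin n) F | E * B.1 * U = 0} : ℂ) := by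
  unfold orbitFourier
  rw [sum_comm, mul_assoc, ← card_univ, ← nsmul_eq_mul, ← sum_const]
  refine sum_congr rfl fun A _ => ?_
  rw [sum_comm, card_filter, Nat.cast_sum, mul_sum]
  refine sum_congr rfl fun B _ => ?_
  have h : ∀ V : Matrix (Fin s) (Fin n) F, (U * V * (A.1 * E * B.1)).trace =
      (V * (A.1 * (E * B.1 * U))).trace := fun V => by
    rw [Matrix.mul_assoc U, trace_mul_comm]
    simp only [Matrix.mul_assoc]
  have h0 : A.1 * (E * B.1 * U) = 0 ↔ E * B.1 * U = 0 := by
    constructor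
    · intro h0
      have := congrArg (fun M => A.1.adjugate * M) h0
      simpa [← Matrix.mul_assoc, adjugate_mul] using this
    · intro h0
      rw [h0, Matrix.mul_zero]
  simp only [h, sum_char_trace hχ, h0]
  split_ifs <;> simp

/-- A combination of orbits with vanishing moments has no Fourier coefficients of small rank. -/
theorem sum_orbitFourier_eq_zero {n J : ℕ} {χ : AddChar F ℂ} (hχ : χ ≠ 1) (hJ : J < n)
    {ι : Type*} [Fintype ι] (w : ι → ℝ) (E : ι → Matrix (Fin n) (Fin n) F)
    (hw : ∀ s ≤ J, ∑ j, w j * ∏ i ∈ range s,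
      ((Fintype.card F : ℝ) ^ (n - (E j).rank) - (Fintype.card F : ℝ) ^ i) = 0)
    (Y : Matrix (Fin n) (Fin n) F) (hY : Y.rank ≤ J) :
    ∑ j, (w j : ℂ) * orbitFourier χ (E j) Y = 0 := by
  induction hr : Y.rank using Nat.strong_induction_on generalizing Y with
  | _ s ih =>
    subst hr
    obtain ⟨U, V, hUV, hU, hV⟩ := exists_rank_factorization Y
    have hs : Y.rank < n := by omega
    have hzero : ∑ V' : Matrix (Fin Y.rank) (Fin n) F,
        ∑ j, (w j : ℂ) * orbitFourier χ (E j) (U * V') = 0 := by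
      rw [sum_comm]
      simp only [← mul_sum, sum_orbitFourier_mul hχ]
      have hpos := prod_pow_sub_pow_pos (F := F) hs.le
      have h1 := hw _ hY
      have h2 : ∑ j, w j * (#{B : SpecialLinearGroup (Fin n) F | E j * B.1 * U = 0} : ℝ) = 0 := by
        refine (mul_eq_zero_iff_right hpos.ne').1 ?_
        rw [sum_mul]
        simp only [mul_assoc, card_mul_mul_eq_zero hs _ hU]
        rw [← mul_zero (Fintype.card (SpecialLinearGroup (Fin n) F) : ℝ), ← h1, mul_sum]
        exact sum_congr rfl fun j _ => mul_left_comm _ _ _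
      have h3 : ∑ j, (w j : ℂ) *
          (#{B : SpecialLinearGroup (Fin n) F | E j * B.1 * U = 0} : ℂ) = 0 := by
        exact_mod_cast h2
      rw [← mul_zero ((Fintype.card (SpecialLinearGroup (Fin n) F) : ℂ) *
        Fintype.card (Matrix (Fin Y.rank) (Fin n) F)), ← h3, mul_sum]
      exact sum_congr rfl fun j _ => mul_left_comm _ _ _
    -- Full-rank `V'` are right `SL n`-translates of `V` and all give the coefficient at `Y`; the
    -- others give smaller rank and vanish by induction. So `hzero` is a positive multiple of the
    -- coefficient at `Y`.
    have hterm : ∀ V' : Matrix (Fin Y.rank) (Fin n) F,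
        ∑ j, (w j : ℂ) * orbitFourier χ (E j) (U * V') =
          if V'.rank = Y.rank then ∑ j, (w j : ℂ) * orbitFourier χ (E j) Y else 0 := fun V' => by
      split_ifs with h
      · obtain ⟨C, hC⟩ := exists_specialLinear_mul_right hs hV h
        refine sum_congr rfl fun j _ => ?_
        rw [← hC, ← Matrix.mul_assoc, ← hUV, orbitFourier_mul_right]
      · have h1 : (U * V').rank ≤ V'.rank := rank_mul_le_right U V'
        have h2 : V'.rank ≤ Y.rank := rank_le_height V'
        exact ih _ (by omega) _ (by omega) rfl
    rw [sum_congr rfl fun V' _ => hterm V', ← sum_filter, sum_const, smul_eq_zero] at hzero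
    refine hzero.resolve_left (card_pos.2 ⟨V, ?_⟩).ne'
    simpa using hV

end OrbitFourier

end Blackboard

namespace Blackboard

open Finset Matrix

/-! ### Extrapolation weights. -/

/-- The extra term `(1 / 16) ^ m / 15` is what lets the induction close; only the bound `14 / 15` is
used later. -/
theorem prod_one_sub_inv_pow_ge (m : ℕ) :
    14 / 15 + (1 / 16 : ℝ) ^ m / 15 ≤ ∏ d ∈ range m, (1 - (1 / 16 : ℝ) ^ (d + 1)) := by
  induction m with
  | zero => norm_num
  | succ m ih =>
    rw [prod_range_succ]
    have hy0 : (0 : ℝ) < (1 / 16) ^ m := by positivity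
    have hy1 : (1 / 16 : ℝ) ^ m ≤ 1 := pow_le_one₀ (by norm_num) (by norm_num)
    rw [pow_succ]
    generalize (1 / 16 : ℝ) ^ m = y at *
    refine le_trans ?_ (mul_le_mul_of_nonneg_right ih (by linarith))
    nlinarith

/-- Weights of an extrapolation formula from rapidly growing nodes to the point `1`. -/
theorem exists_extrapolation_weights {Q G : ℝ} (hQ : 1 < Q) (hG : 16 ≤ G) (J : ℕ) :
    ∃ c : ℕ → ℝ, (∀ P : Polynomial ℝ, P.natDegree ≤ J →
        ∑ j ∈ range (J + 1), c j * P.eval (Q * G ^ j) = P.eval 1) ∧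
      ∑ j ∈ range J, |c (j + 1)| ≤ 1 / 10 := by
  let z : ℕ → ℝ := fun j => Q * G ^ j
  have hz1 : ∀ i, 1 < z i := fun i =>
    one_lt_mul_of_lt_of_le hQ (one_le_pow₀ (by linarith))
  have hz : ∀ i d, 16 ^ d * z i ≤ z (i + d) := fun i d => by
    simp only [z]
    calc 16 ^ d * (Q * G ^ i) ≤ G ^ d * (Q * G ^ i) := by gcongr
      _ = Q * G ^ (i + d) := by ring
  have hmono : StrictMono z := strictMono_nat_of_lt_succ fun i => by
    have := hz i 1
    have := hz1 i
    linarith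
  have hinj : Set.InjOn z (range (J + 1)) := hmono.injective.injOn
  refine ⟨fun j => (Lagrange.basis (range (J + 1)) z j).eval 1, fun P hP => ?_, ?_⟩
  · have hdeg : P.degree < #(range (J + 1)) := by
      rw [card_range]
      exact Polynomial.degree_le_natDegree.trans_lt (by exact_mod_cast Nat.lt_succ_of_le hP)
    conv_rhs => rw [Lagrange.eq_interpolate hinj hdeg]
    rw [Lagrange.interpolate_apply, Polynomial.eval_finsetSum]
    refine sum_congr rfl fun j _ => ?_
    rw [Polynomial.eval_mul, Polynomial.eval_C, mul_comm]
  · have hbound : ∀ j < J + 1,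
        |(Lagrange.basis (range (J + 1)) z j).eval 1| ≤ (1 / 15) ^ j * (15 / 14) := by
      intro j hj
      have hsplit : (range (J + 1)).erase j = range j ∪ Ico (j + 1) (J + 1) := by
        ext i
        simp only [mem_erase, mem_range, mem_union, mem_Ico]
        omega
      have hdisj : Disjoint (range j) (Ico (j + 1) (J + 1)) := by
        rw [disjoint_left]
        intro i hi hi'
        simp only [mem_range, mem_Ico] at hi hi'
        omega
      rw [Lagrange.basis, Polynomial.eval_prod, abs_prod, hsplit, prod_union hdisj]
      have heval : ∀ i, |(Lagrange.basisDivisor (z j) (z i)).eval 1| =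
          (z i - 1) / |z j - z i| := fun i => by
        rw [Lagrange.basisDivisor]
        simp only [Polynomial.eval_mul, Polynomial.eval_C, Polynomial.eval_sub, Polynomial.eval_X]
        rw [abs_mul, abs_inv, abs_sub_comm 1, abs_of_pos (sub_pos.2 (hz1 i)), mul_comm]
        rfl
      simp only [heval]
      refine mul_le_mul ?_ ?_ (prod_nonneg fun i _ => ?_) (by positivity)
      · refine (prod_le_prod (fun i _ => ?_) (g := fun _ => (1 / 15 : ℝ)) fun i hi => ?_).trans
          (by simp)
        · exact div_nonneg (sub_pos.2 (hz1 i)).le (abs_nonneg _)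
        · have hij := mem_range.1 hi
          have h1 := hz i 1
          have h2 : z (i + 1) ≤ z j := hmono.monotone hij
          have h3 := hz1 i
          rw [abs_of_pos (by linarith), div_le_iff₀ (by linarith)]
          linarith
      · rw [prod_Ico_eq_prod_range]
        have hpos : ∀ d : ℕ, 0 < 1 - (1 / 16 : ℝ) ^ (d + 1) := fun d =>
          sub_pos.2 (pow_lt_one₀ (by norm_num) (by norm_num) (by omega))
        refine (prod_le_prod (fun k _ => ?_)
          (g := fun k => (1 - (1 / 16 : ℝ) ^ (k + 1))⁻¹) fun k _ => ?_).trans ?_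
        · exact div_nonneg (sub_pos.2 (hz1 _)).le (abs_nonneg _)
        · have h1 := hz j (k + 1)
          rw [show j + (k + 1) = j + 1 + k by ring] at h1
          have h2 : z j < z (j + 1 + k) := hmono (by omega)
          have h3 := hz1 (j + 1 + k)
          rw [abs_sub_comm, abs_of_pos (by linarith), div_le_iff₀ (by linarith), inv_mul_eq_div,
            le_div_iff₀ (hpos k)]
          have h4 : z j ≤ (1 / 16) ^ (k + 1) * z (j + 1 + k) := by
            rw [one_div, inv_pow, inv_mul_eq_div, le_div_iff₀ (by positivity)]
            linarith
          have h5 := hpos k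
          nlinarith
        · rw [prod_inv_distrib, inv_le_comm₀ (prod_pos fun d _ => hpos d) (by norm_num)]
          refine le_trans ?_ (prod_one_sub_inv_pow_ge _)
          have : (0 : ℝ) ≤ (1 / 16) ^ (J + 1 - (j + 1)) := by positivity
          norm_num
          positivity
      · exact div_nonneg (sub_pos.2 (hz1 i)).le (abs_nonneg _)
    calc ∑ j ∈ range J, |(Lagrange.basis (range (J + 1)) z (j + 1)).eval 1|
        ≤ ∑ j ∈ range J, (1 / 15 : ℝ) ^ j * (1 / 14) := by
          refine sum_le_sum fun j hj => (hbound (j + 1) ?_).trans (le_of_eq ?_)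
          · have := mem_range.1 hj
            omega
          · rw [pow_succ]
            ring
      _ ≤ 1 / 10 := by
          rw [← sum_mul, geom_sum_eq (by norm_num)]
          have : (0 : ℝ) ≤ (1 / 15) ^ J := by positivity
          generalize (1 / 15 : ℝ) ^ J = y at *
          rw [show (y - 1) / (1 / 15 - 1) = (1 - y) * (15 / 14) by ring]
          linarith

/-! ### Orbit laws as test functions. -/

section OrbitLaw

variable {F : Type u} [Field F] [Fintype F] [DecidableEq F] {n : ℕ}

/-- The law of `A * E * B` for uniform and independent `A` and `B` in `SL n`. -/
noncomputable def orbitLaw (E M : Matrix (Fin n) (Fin n) F) : ℝ :=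
  (∑ A : SpecialLinearGroup (Fin n) F, ∑ B : SpecialLinearGroup (Fin n) F,
    if A.1 * E * B.1 = M then 1 else 0) / (Fintype.card (SpecialLinearGroup (Fin n) F) : ℝ) ^ 2

/-- The mean of `g (A * E * B)` for uniform and independent `A` and `B` in `SL n`. -/
noncomputable def orbitMean (g : Matrix (Fin n) (Fin n) F → ℝ) (E : Matrix (Fin n) (Fin n) F) : ℝ :=
  (∑ A : SpecialLinearGroup (Fin n) F, ∑ B : SpecialLinearGroup (Fin n) F, g (A.1 * E * B.1)) /
    (Fintype.card (SpecialLinearGroup (Fin n) F) : ℝ) ^ 2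

theorem card_specialLinear_pos : 0 < (Fintype.card (SpecialLinearGroup (Fin n) F) : ℝ) :=
  Nat.cast_pos.2 Fintype.card_pos

theorem sum_orbitLaw_mul (E : Matrix (Fin n) (Fin n) F) (g : Matrix (Fin n) (Fin n) F → ℝ) :
    ∑ M, orbitLaw E M * g M = orbitMean g E := by
  unfold orbitLaw orbitMean
  simp only [div_mul_eq_mul_div, ← sum_div, sum_mul]
  rw [sum_comm]
  simp_rw [sum_comm (s := (univ : Finset (Matrix (Fin n) (Fin n) F)))]
  simp

theorem sum_orbitLaw_mul_traceChar (χ : AddChar F ℂ) (E Y : Matrix (Fin n) (Fin n) F) :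
    ∑ M, (orbitLaw E M : ℂ) * traceChar χ Y M =
      orbitFourier χ E Y / (Fintype.card (SpecialLinearGroup (Fin n) F) : ℂ) ^ 2 := by
  unfold orbitLaw orbitFourier
  push_cast
  simp only [div_mul_eq_mul_div, ← sum_div, sum_mul]
  rw [sum_comm]
  simp_rw [sum_comm (s := (univ : Finset (Matrix (Fin n) (Fin n) F)))]
  simp [traceChar_apply, apply_ite Complex.ofReal]

theorem le_orbitMean {g : Matrix (Fin n) (Fin n) F → ℝ} {E : Matrix (Fin n) (Fin n) F} {c : ℝ}
    (h : ∀ A B : SpecialLinearGroup (Fin n) F, c ≤ g (A.1 * E * B.1)) : c ≤ orbitMean g E := by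
  unfold orbitMean
  rw [le_div_iff₀ (pow_pos card_specialLinear_pos 2)]
  refine le_trans (le_of_eq ?_) (sum_le_sum fun A _ => sum_le_sum fun B _ => h A B)
  simp only [sum_const, card_univ, nsmul_eq_mul]
  ring

theorem orbitMean_const_mul (a : ℝ) (g : Matrix (Fin n) (Fin n) F → ℝ)
    (E : Matrix (Fin n) (Fin n) F) : orbitMean (fun M => a * g M) E = a * orbitMean g E := by
  unfold orbitMean
  simp only [← mul_sum, mul_div_assoc]

theorem abs_orbitMean_le {g : Matrix (Fin n) (Fin n) F → ℝ} (h : ∀ M, |g M| ≤ 1)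
    (E : Matrix (Fin n) (Fin n) F) : |orbitMean g E| ≤ 1 := by
  rw [abs_le]
  refine ⟨le_orbitMean fun A B => (abs_le.1 (h _)).1, ?_⟩
  have h1 : -1 ≤ orbitMean (fun M => -1 * g M) E :=
    le_orbitMean fun A B => by linarith [(abs_le.1 (h (A.1 * E * B.1))).2]
  rw [orbitMean_const_mul] at h1
  linarith

theorem orbitLaw_nonneg (E M : Matrix (Fin n) (Fin n) F) : 0 ≤ orbitLaw E M :=
  div_nonneg (sum_nonneg fun A _ => sum_nonneg fun B _ => by split_ifs <;> norm_num) (by positivity)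

theorem sum_orbitLaw (E : Matrix (Fin n) (Fin n) F) : ∑ M, orbitLaw E M = 1 := by
  have h := sum_orbitLaw_mul E fun _ => 1
  simp only [mul_one] at h
  rw [h]
  unfold orbitMean
  rw [div_eq_one_iff_eq (pow_pos card_specialLinear_pos 2).ne']
  simp [sq]

/-- Lower bounds from a signed combination of orbits of `SL n × SL n`. -/
theorem le_randCC_of_orbits {ι : Type*} [Fintype ι] {J : ℕ} (hJ : J < n) (w : ι → ℝ)
    (E : ι → Matrix (Fin n) (Fin n) F)
    (hw : ∀ s ≤ J, ∑ j, w j * ∏ i ∈ range s,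
      ((Fintype.card F : ℝ) ^ (n - (E j).rank) - (Fintype.card F : ℝ) ^ i) = 0)
    {η : ℝ} (hη0 : 0 ≤ η)
    (hη : ∀ χ : AddChar F ℂ, χ ≠ 1 → ∀ j, ∀ Y : Matrix (Fin n) (Fin n) F, J < Y.rank →
      ‖orbitFourier χ (E j) Y‖ ≤
        η * (Fintype.card (SpecialLinearGroup (Fin n) F) : ℝ) ^ 2)
    (f : Matrix (Fin n) (Fin n) F → Option ℤˣ) (sgn : ι → Option ℤˣ)
    (hf : ∀ j v, sgn j = some v → ∀ A B : SpecialLinearGroup (Fin n) F,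
      f (A.1 * E j * B.1) = some v) {κ L : ℝ} (hL : ∑ j, |w j| ≤ L)
    (hκ : ∀ a : ι → ℝ, (∀ j, |a j| ≤ 1) → (∀ j v, sgn j = some v → 1 / 3 ≤ ((v : ℤ) : ℝ) * a j) →
      κ ≤ ∑ j, w j * a j) {t : ℕ} (ht : 2 ≤ t) :
    κ * t ≤ 2 * L * randCC (1 / 3) (sumProblem f t) ∧
      ∀ l : ℕ, κ ≤ 2 * randCC (1 / 3) (sumProblem f t) * L / (t * (l + 1)) + 2 ^ l * (L * η) := by
  obtain ⟨χ, hχ⟩ := exists_nontrivial_char F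
  have hN := card_specialLinear_pos (F := F) (n := n)
  let ψ : Matrix (Fin n) (Fin n) F → ℝ := fun M => ∑ j, w j * orbitLaw (E j) M
  have hψ : ∀ g : Matrix (Fin n) (Fin n) F → ℝ,
      ∑ M, ψ M * g M = ∑ j, w j * orbitMean g (E j) := fun g => by
    simp only [ψ, sum_mul]
    rw [sum_comm]
    refine sum_congr rfl fun j _ => ?_
    rw [← sum_orbitLaw_mul, mul_sum]
    exact sum_congr rfl fun M _ => mul_assoc _ _ _
  have hψL : ∑ M, |ψ M| ≤ L := by
    refine le_trans ?_ hL
    calc ∑ M, |ψ M| ≤ ∑ M, ∑ j, |w j| * orbitLaw (E j) M := by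
          refine sum_le_sum fun M _ => (abs_sum_le_sum_abs _ _).trans (le_of_eq ?_)
          refine sum_congr rfl fun j _ => ?_
          rw [abs_mul, abs_of_nonneg (orbitLaw_nonneg _ _)]
      _ = ∑ j, |w j| := by
          rw [sum_comm]
          refine sum_congr rfl fun j _ => ?_
          rw [← mul_sum, sum_orbitLaw, mul_one]
  have hψκ : ∀ h : Matrix (Fin n) (Fin n) F → ℝ, (∀ m, |h m| ≤ 1) →
      (∀ m v, f m = some v → 1 / 3 ≤ ((v : ℤ) : ℝ) * h m) → κ ≤ ∑ m, ψ m * h m := by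
    intro h h1 h2
    rw [hψ]
    refine hκ _ (fun j => abs_orbitMean_le h1 _) fun j v hj => ?_
    rw [← orbitMean_const_mul]
    exact le_orbitMean fun A B => h2 _ v (hf j v hj A B)
  -- The moment condition for `s = 0`.
  have hψ0 : ∑ M, ψ M = 0 := by
    have h0 := hw 0 (Nat.zero_le J)
    simp only [range_zero, prod_empty, mul_one] at h0
    rw [← h0]
    simp only [ψ]
    rw [sum_comm]
    refine sum_congr rfl fun j _ => ?_
    rw [← mul_sum, sum_orbitLaw, mul_one]
  refine ⟨le_randCC_of_sum_eq_zero f ht ψ hψκ hψL hψ0, fun l => ?_⟩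
  refine le_randCC_of_discrepancy f ht ψ hψκ hψL (fun S T => ?_) l
  refine abs_sum_rectangle_le (Y := Matrix (Fin n) (Fin n) F) (traceChar χ) ?_ ψ ?_ S T
  · intro M
    simpa only [traceChar_apply] using sum_char_trace hχ M
  · intro Y
    have hF : ∑ M, (ψ M : ℂ) * traceChar χ Y M =
        (∑ j, (w j : ℂ) * orbitFourier χ (E j) Y) /
          (Fintype.card (SpecialLinearGroup (Fin n) F) : ℂ) ^ 2 := by
      simp only [ψ]
      push_cast
      simp only [sum_mul]
      rw [sum_comm, sum_div]
      refine sum_congr rfl fun j _ => ?_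
      rw [mul_div_assoc, ← sum_orbitLaw_mul_traceChar, mul_sum]
      exact sum_congr rfl fun M _ => mul_assoc _ _ _
    have hL0 : 0 ≤ L := (sum_nonneg fun j _ => abs_nonneg _).trans hL
    rw [hF]
    by_cases hY : Y.rank ≤ J
    · rw [sum_orbitFourier_eq_zero hχ hJ w E hw Y hY, zero_div, norm_zero]
      positivity
    · push Not at hY
      rw [norm_div, norm_pow, Complex.norm_natCast, div_le_iff₀ (pow_pos hN 2)]
      calc ‖∑ j, (w j : ℂ) * orbitFourier χ (E j) Y‖
          ≤ ∑ j, |w j| * (η * (Fintype.card (SpecialLinearGroup (Fin n) F) : ℝ) ^ 2) := by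
            refine (norm_sum_le _ _).trans (sum_le_sum fun j _ => ?_)
            rw [norm_mul, Complex.norm_real, Real.norm_eq_abs]
            exact mul_le_mul_of_nonneg_left (hη χ hχ j Y hY) (abs_nonneg _)
        _ ≤ _ := by
            rw [← sum_mul, ← mul_assoc]
            gcongr

end OrbitLaw

/-- The quantitative conclusion of the discrepancy method. -/
theorem le_of_discrepancy_bounds {κ L η C q : ℝ} {t e : ℕ} (ht : 2 ≤ t) (hC : 0 ≤ C) (hq : 1 < q)
    (hκ : 1 / 2 ≤ κ) (hL0 : 0 ≤ L) (hL : L ≤ 3) (hη0 : 0 ≤ η) (hη : η ≤ 2 / q ^ e)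
    (h1 : κ * t ≤ 2 * L * C) (h2 : ∀ l : ℕ, κ ≤ 2 * C * L / (t * (l + 1)) + 2 ^ l * (L * η)) :
    t + t * (e * Real.logb 2 q) ≤ 96 * C := by
  have ht0 : (0 : ℝ) < t := by exact_mod_cast (by omega : 0 < t)
  have h3 : (t : ℝ) ≤ 12 * C := by nlinarith [mul_le_mul_of_nonneg_right hL hC]
  set X := e * Real.logb 2 q with hX
  have h4 : t * (X - 5) ≤ 24 * C := by
    by_cases hX5 : X < 5
    · nlinarith
    · push Not at hX5
      -- The offset `5` makes `2 ^ l ≤ q ^ e / 32`, so the discrepancy term is at most `6 / 32`,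
      -- below half of `κ`.
      set l := ⌊X - 5⌋₊ with hl
      have hl1 : (l : ℝ) ≤ X - 5 := Nat.floor_le (by linarith)
      have hl2 : X - 5 < l + 1 := Nat.lt_floor_add_one _
      have hpow : (2 : ℝ) ^ X = q ^ e := by
        rw [hX, mul_comm, Real.rpow_mul (by norm_num),
          Real.rpow_logb (by norm_num) (by norm_num) (by linarith), Real.rpow_natCast]
      have h2l : (2 : ℝ) ^ l ≤ q ^ e / 32 := by
        rw [← hpow, ← Real.rpow_natCast]
        refine (Real.rpow_le_rpow_of_exponent_le (by norm_num) hl1).trans (le_of_eq ?_)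
        rw [Real.rpow_sub (by norm_num)]
        norm_num
      have hqe : 0 < q ^ e := by positivity
      have h5 : 2 ^ l * (L * η) ≤ 1 / 4 := by
        calc 2 ^ l * (L * η) ≤ q ^ e / 32 * (3 * (2 / q ^ e)) := by gcongr
          _ ≤ 1 / 4 := by
            field_simp
            norm_num
      have h6 := h2 l
      have h7 : 1 / 4 ≤ 2 * C * L / (t * (l + 1)) := by linarith
      rw [le_div_iff₀ (by positivity)] at h7
      nlinarith [mul_le_mul_of_nonneg_right hL hC]
  nlinarith

end Blackboard

namespace Blackboard

open Finset Matrix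

/-! ### Orbit representatives and the lower bounds for matrix problems. -/

section Representatives

variable {F : Type u} [Field F] {n : ℕ}

theorem rank_diagonal_ite_lt {k : ℕ} (hk : k ≤ n) :
    (diagonal fun i : Fin n => if i.1 < k then (1 : F) else 0).rank = k := by
  classical
  rw [rank_diagonal, Fintype.card_subtype]
  simp [Fin.card_filter_val_lt, hk]

/-- A diagonal matrix of determinant `a`. -/
def diagonalOfDet (n : ℕ) (a : F) : Matrix (Fin n) (Fin n) F :=
  diagonal fun i => if i.1 = 0 then a else 1

theorem det_diagonalOfDet (hn : 0 < n) (a : F) : (diagonalOfDet n a).det = a := by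
  rw [diagonalOfDet, det_diagonal, prod_eq_single (⟨0, hn⟩ : Fin n)]
  · simp
  · intro i _ hi
    rw [if_neg fun h => hi (Fin.ext h)]
  · simp

theorem rank_of_det_ne {M : Matrix (Fin n) (Fin n) F} (h : M.det ≠ 0) : M.rank = n := by
  rw [rank_of_det_ne_zero h, Fintype.card_fin]

theorem rank_orbit (A B : SpecialLinearGroup (Fin n) F) (E : Matrix (Fin n) (Fin n) F) :
    (A.1 * E * B.1).rank = E.rank := by
  rw [rank_specialLinear_mul]
  exact rank_mul_eq_right_of_isUnit_det _ _ (by rw [A.2]; exact isUnit_one)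

theorem det_orbit (A B : SpecialLinearGroup (Fin n) F) (E : Matrix (Fin n) (Fin n) F) :
    (A.1 * E * B.1).det = E.det := by
  rw [det_mul, det_mul, A.2, B.2, one_mul, mul_one]

end Representatives

/-- With `J = r / 8`, ranks stay above about `r / 2` while surviving frequencies have rank at least
`J + 1`, so the exponent is quadratic in `r`. The case `r = 1` needs the separate rank-one bound and
`r = 0` is trivial; these account for the constant `2`. -/
theorem exists_orbitFourier_bound (F : Type u) [Field F] [Fintype F] [DecidableEq F] {n r : ℕ}
    (hr : r < n) :
    ∃ e : ℕ, r ^ 2 ≤ 64 * e ∧ ∀ χ : AddChar F ℂ, χ ≠ 1 → ∀ E Y : Matrix (Fin n) (Fin n) F,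
      r - 4 * (r / 8) ≤ E.rank → r / 8 < Y.rank → ‖orbitFourier χ E Y‖ ≤
        2 / (Fintype.card F : ℝ) ^ e * (Fintype.card (SpecialLinearGroup (Fin n) F) : ℝ) ^ 2 := by
  rcases Nat.lt_or_ge r 2 with h2 | h2
  · interval_cases r
    · refine ⟨0, by norm_num, fun χ hχ E Y _ _ => ?_⟩
      refine (norm_orbitFourier_le_of_rank hχ hr (zero_le (a := Y.rank))
        (zero_le (a := E.rank))).trans ?_
      simp only [zero_mul, pow_zero, div_one]
      nlinarith [sq_nonneg (Fintype.card (SpecialLinearGroup (Fin n) F) : ℝ)]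
    · refine ⟨1, by norm_num, fun χ hχ E Y hE hY => ?_⟩
      refine (norm_orbitFourier_le_of_ne_zero hχ hr hY hE).trans (le_of_eq ?_)
      rw [pow_one]
      ring
  · refine ⟨(r / 8 + 1) * (r - 4 * (r / 8) - (r / 8 + 1)), ?_, fun χ hχ E Y hE hY => ?_⟩
    · obtain ⟨J, d, hd, hJ, hrd⟩ : ∃ J d, d < 8 ∧ r / 8 = J ∧ r = 8 * J + d :=
        ⟨r / 8, r % 8, by omega, rfl, by omega⟩
      rw [hJ, sq]
      rcases Nat.eq_zero_or_pos J with h0 | h0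
      · subst h0
        have : r < 8 := by omega
        interval_cases r <;> norm_num
      · calc r * r ≤ (8 * (J + 1)) * (8 * (r - 4 * J - (J + 1))) :=
              Nat.mul_le_mul (by omega) (by omega)
          _ = _ := by ring
    · refine (norm_orbitFourier_le_of_rank hχ (s := r / 8 + 1) (by omega) hY hE).trans ?_
      rw [div_mul_eq_mul_div]
      gcongr
      nlinarith [sq_nonneg (Fintype.card (SpecialLinearGroup (Fin n) F) : ℝ)]

/-- Distinguishing the matrices of rank `r` from the matrices of determinant `a ≠ 0`. -/
theorem le_randCC_rank_vs_det {F : Type u} [Field F] [Fintype F] {n r : ℕ} (hr : r < n) {a : F}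
    (ha : a ≠ 0) (f : Matrix (Fin n) (Fin n) F → Option ℤˣ) (v : ℤˣ)
    (hf1 : ∀ M : Matrix (Fin n) (Fin n) F, M.rank = r → f M = some v)
    (hf2 : ∀ M : Matrix (Fin n) (Fin n) F, M.det = a → f M = some (-v)) {t : ℕ} (ht : 2 ≤ t) :
    t + t * r ^ 2 * Real.logb 2 (Fintype.card F) ≤
      6144 * (randCC (1 / 3) (sumProblem f t) : ℝ) := by
  classical
  have hq1 : 1 < (Fintype.card F : ℝ) := by exact_mod_cast Fintype.one_lt_card (α := F)
  have hq2 : 2 ≤ (Fintype.card F : ℝ) := by exact_mod_cast Fintype.one_lt_card (α := F)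
  set q := (Fintype.card F : ℝ) with hq
  set J := r / 8 with hJ
  -- The node `q ^ (n - r) * (q ^ 4) ^ j` belongs to rank `r - 4j`, and the target `1` to rank `n`.
  -- The step of four in the rank ensures a growth factor of at least `16` even for `q = 2`.
  obtain ⟨c, hc, hcsum⟩ := exists_extrapolation_weights (Q := q ^ (n - r)) (G := q ^ 4)
    (one_lt_pow₀ hq1 (by omega))
    (calc (16 : ℝ) = 2 ^ 4 := by norm_num
      _ ≤ q ^ 4 := by gcongr) J
  obtain ⟨e, he, hbound⟩ := exists_orbitFourier_bound F hr
  let E : Option (Fin (J + 1)) → Matrix (Fin n) (Fin n) F := fun j =>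
    j.elim (diagonalOfDet n a) fun j => diagonal fun i => if i.1 < r - 4 * j.1 then 1 else 0
  let w : Option (Fin (J + 1)) → ℝ := fun j => j.elim (-((v : ℤ) : ℝ)) fun j => ((v : ℤ) : ℝ) * c j
  -- Only rank `r` and determinant `a` carry a prescribed value. The auxiliary ranks are
  -- unconstrained, and their total weight of at most `1 / 10` leaves correlation at least `(9 / 10)
  -- / 3 + 1 / 3 - 1 / 10 > 1 / 2`.
  let sgn : Option (Fin (J + 1)) → Option ℤˣ := fun j =>
    j.elim (some (-v)) fun j => if j = 0 then some v else none
  have hEnone : (E none).rank = n := rank_of_det_ne (by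
    change (diagonalOfDet n a).det ≠ 0
    rwa [det_diagonalOfDet (by omega)])
  have hEsome : ∀ j : Fin (J + 1), (E (some j)).rank = r - 4 * j.1 := fun j =>
    rank_diagonal_ite_lt (by omega)
  have hc0 : |c 0 - 1| ≤ 1 / 10 := by
    have h := hc 1 (by simp)
    simp only [Polynomial.eval_one, mul_one] at h
    rw [sum_range_succ'] at h
    rw [show c 0 - 1 = -∑ j ∈ range J, c (j + 1) by linarith, abs_neg]
    exact (abs_sum_le_sum_abs _ _).trans hcsum
  have hc0' := abs_le.1 hc0
  have hmoments : ∀ s ≤ J, ∑ j, w j * ∏ i ∈ range s, (q ^ (n - (E j).rank) - q ^ i) = 0 := by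
    intro s hs
    let P : Polynomial ℝ := ∏ i ∈ range s, (Polynomial.X - Polynomial.C (q ^ i))
    have hP : P.natDegree ≤ J := by
      rw [Polynomial.natDegree_finsetProd_X_sub_C_eq_card, card_range]
      exact hs
    have hPe : ∀ x, P.eval x = ∏ i ∈ range s, (x - q ^ i) := fun x => by
      simp [P, Polynomial.eval_prod]
    simp only [← hPe]
    rw [Fintype.sum_option, hEnone, Nat.sub_self, pow_zero, ← hc P hP, ← Fin.sum_univ_eq_sum_range
      (fun j => c j * P.eval (q ^ (n - r) * (q ^ 4) ^ j)), mul_sum, ← sum_add_distrib]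
    refine sum_eq_zero fun j _ => ?_
    rw [hEsome, show n - (r - 4 * j.1) = (n - r) + 4 * j.1 by omega, pow_add, pow_mul]
    simp only [w, Option.elim]
    ring
  have hL : ∑ j, |w j| ≤ 3 := by
    rw [Fintype.sum_option, Fin.sum_univ_succ]
    simp only [w, Option.elim, abs_neg, abs_mul, Protocol.abs_unit_real, one_mul, Fin.val_zero,
      Fin.val_succ]
    rw [Fin.sum_univ_eq_sum_range (fun j => |c (j + 1)|)]
    have : |c 0| ≤ 11 / 10 := abs_le.2 ⟨by linarith, by linarith⟩
    linarith
  have hκ : ∀ b : Option (Fin (J + 1)) → ℝ, (∀ j, |b j| ≤ 1) →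
      (∀ j u, sgn j = some u → 1 / 3 ≤ ((u : ℤ) : ℝ) * b j) → 1 / 2 ≤ ∑ j, w j * b j := by
    intro b hb1 hb2
    have h1 := hb2 none (-v) rfl
    have h2 := hb2 (some 0) v (by simp [sgn])
    have h3 : |∑ j : Fin J, w (some j.succ) * b (some j.succ)| ≤ 1 / 10 := by
      refine (abs_sum_le_sum_abs _ _).trans (le_trans ?_ hcsum)
      rw [← Fin.sum_univ_eq_sum_range (fun j => |c (j + 1)|)]
      refine sum_le_sum fun j _ => ?_
      simp only [w, Option.elim, abs_mul, Protocol.abs_unit_real, one_mul, Fin.val_succ]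
      exact mul_le_of_le_one_right (abs_nonneg _) (hb1 _)
    rw [Fintype.sum_option, Fin.sum_univ_succ]
    have h4 := (abs_le.1 h3).1
    have h5 : w none * b none = (((-v : ℤˣ) : ℤ) : ℝ) * b none := by
      simp [w]
    have h6 : w (some 0) * b (some 0) = c 0 * (((v : ℤ) : ℝ) * b (some 0)) := by
      simp only [w, Option.elim, Fin.val_zero]
      ring
    rw [h5, h6]
    nlinarith
  have hf : ∀ j u, sgn j = some u → ∀ A B : SpecialLinearGroup (Fin n) F,
      f (A.1 * E j * B.1) = some u := by
    intro j u hj A B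
    rcases j with _ | j
    · rw [← hj]
      refine hf2 _ ?_
      rw [det_orbit]
      exact det_diagonalOfDet (by omega) a
    · by_cases h0 : j = 0
      · subst h0
        rw [← hj]
        refine (hf1 _ ?_).trans (by simp [sgn])
        rw [rank_orbit, hEsome]
        simp
      · simp [sgn, h0] at hj
  obtain ⟨h1, h2⟩ := le_randCC_of_orbits (J := J) (by omega) w E hmoments
    (η := 2 / q ^ e) (by positivity) (fun χ hχ j Y hY => hbound χ hχ (E j) Y (by
      rcases j with _ | j
      · rw [hEnone]
        omega
      · rw [hEsome]
        have := j.2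
        omega) hY) f sgn hf hL hκ ht
  have h := le_of_discrepancy_bounds ht (Nat.cast_nonneg _) hq1 le_rfl (by norm_num) le_rfl
    (by positivity) le_rfl h1 h2
  have hlog : 0 ≤ Real.logb 2 q := Real.logb_nonneg (by norm_num) hq1.le
  have he' : (r : ℝ) ^ 2 ≤ 64 * e := by exact_mod_cast he
  have h3 : t * (r : ℝ) ^ 2 * Real.logb 2 q ≤ 64 * (t * (e * Real.logb 2 q)) := by
    calc t * (r : ℝ) ^ 2 * Real.logb 2 q ≤ t * (64 * e) * Real.logb 2 q := by gcongr
      _ = _ := by ring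
  have h4 : (0 : ℝ) ≤ t := Nat.cast_nonneg t
  linarith

/-- Distinguishing two nonzero values of the determinant. -/
theorem le_randCC_det_vs_det {F : Type u} [Field F] [Fintype F] {n : ℕ} (hn : 2 ≤ n) {a b : F}
    (ha : a ≠ 0) (hb : b ≠ 0) (f : Matrix (Fin n) (Fin n) F → Option ℤˣ)
    (hf1 : ∀ M : Matrix (Fin n) (Fin n) F, M.det = a → f M = some (-1))
    (hf2 : ∀ M : Matrix (Fin n) (Fin n) F, M.det = b → f M = some 1) {t : ℕ} (ht : 2 ≤ t) :
    t * n ^ 2 * Real.logb 2 (Fintype.card F) ≤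
      768 * (randCC (1 / 3) (sumProblem f t) : ℝ) := by
  classical
  have hq1 : 1 < (Fintype.card F : ℝ) := by exact_mod_cast Fintype.one_lt_card (α := F)
  set q := (Fintype.card F : ℝ) with hq
  let E : Bool → Matrix (Fin n) (Fin n) F := fun j => diagonalOfDet n (bif j then b else a)
  have hdet : ∀ j, (E j).det = bif j then b else a := fun j => det_diagonalOfDet (by omega) _
  have hrank : ∀ j, (E j).rank = n := fun j => rank_of_det_ne (by
    rw [hdet]
    cases j <;> assumption)
  -- Both orbits have rank `n`, so opposite weights cancel every moment and only invertible `Y`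
  -- remain. For these, `s = n / 2` makes the exponent `s * (n - s)` as large as possible.
  obtain ⟨h1, h2⟩ := le_randCC_of_orbits (J := n - 1) (by omega)
    (fun j : Bool => bif j then 1 else -1) E (by
      intro s _
      simp [hrank]) (η := 2 / q ^ (n / 2 * (n - n / 2))) (by positivity) (by
      intro χ hχ j Y hY
      refine (norm_orbitFourier_le_of_rank hχ (s := n / 2) (by omega) (by omega)
        (hrank j).ge).trans ?_
      rw [div_mul_eq_mul_div]
      gcongr
      nlinarith [sq_nonneg (Fintype.card (SpecialLinearGroup (Fin n) F) : ℝ)]) f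
    (fun j => some (bif j then 1 else -1)) (by
      intro j u hj A B
      rw [← hj]
      cases j
      · exact hf1 _ (by rw [det_orbit, hdet]; rfl)
      · exact hf2 _ (by rw [det_orbit, hdet]; rfl)) (L := 3) (by norm_num) (κ := 1 / 2) (by
      intro c _ hc
      have h1 := hc true 1 rfl
      have h2 := hc false (-1) rfl
      simp at h1 h2 ⊢
      linarith) ht
  have h := le_of_discrepancy_bounds ht (Nat.cast_nonneg _) hq1 le_rfl (by norm_num) le_rfl
    (by positivity) le_rfl h1 h2
  have hlog : 0 ≤ Real.logb 2 q := Real.logb_nonneg (by norm_num) hq1.le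
  have he : n ^ 2 ≤ 8 * (n / 2 * (n - n / 2)) := by
    calc n ^ 2 = n * n := sq n
      _ ≤ (4 * (n / 2)) * (2 * (n - n / 2)) := Nat.mul_le_mul (by omega) (by omega)
      _ = _ := by ring
  have he' : (n : ℝ) ^ 2 ≤ 8 * (n / 2 * (n - n / 2) : ℕ) := by exact_mod_cast he
  have h3 : t * (n : ℝ) ^ 2 * Real.logb 2 q ≤
      8 * (t * ((n / 2 * (n - n / 2) : ℕ) * Real.logb 2 q)) := by
    calc t * (n : ℝ) ^ 2 * Real.logb 2 q
        ≤ t * (8 * (n / 2 * (n - n / 2) : ℕ)) * Real.logb 2 q := by gcongr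
      _ = _ := by ring
  have h4 : (0 : ℝ) ≤ t := Nat.cast_nonneg t
  linarith

/-! ### The three problems of the theorem. -/

/-- The matrix of the inclusion of the first `R` coordinates. -/
def coordInclusion (F : Type u) [Field F] (n R : ℕ) : Matrix (Fin n) (Fin R) F :=
  Matrix.of fun i j => if i.1 = j.1 then 1 else 0

theorem coordInclusion_transpose_mul (F : Type u) [Field F] {n R : ℕ} (h : R ≤ n) :
    (coordInclusion F n R)ᵀ * coordInclusion F n R = 1 := by
  ext i j
  rw [mul_apply, sum_eq_single (⟨i.1, i.2.trans_le h⟩ : Fin n)]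
  · simp [coordInclusion, one_apply, Fin.ext_iff]
  · intro k _ hk
    simp only [transpose_apply, coordInclusion, of_apply]
    rw [if_neg fun h => hk (Fin.ext h), zero_mul]
  · simp

theorem rank_coordInclusion_mul (F : Type u) [Field F] {n m R : ℕ} (hn : R ≤ n) (hm : R ≤ m)
    (M : Matrix (Fin R) (Fin R) F) :
    (coordInclusion F n R * M * (coordInclusion F m R)ᵀ).rank = M.rank := by
  refine le_antisymm ((rank_mul_le_left _ _).trans (rank_mul_le_right _ _)) ?_
  have h : M = (coordInclusion F n R)ᵀ *
      (coordInclusion F n R * M * (coordInclusion F m R)ᵀ) * coordInclusion F m R := by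
    calc M = ((coordInclusion F n R)ᵀ * coordInclusion F n R) * M *
        ((coordInclusion F m R)ᵀ * coordInclusion F m R) := by
          rw [coordInclusion_transpose_mul F hn, coordInclusion_transpose_mul F hm,
            Matrix.one_mul, Matrix.mul_one]
      _ = _ := by simp only [Matrix.mul_assoc]
  conv_lhs => rw [h]
  exact (rank_mul_le_left _ _).trans (rank_mul_le_right _ _)

/-- Padding by zeros is linear and preserves rank, so each player can embed an `R × R` matrix
locally. Among square matrices of size `R`, those of determinant `1` have rank `R`. -/
theorem le_randCC_rankProblem {F : Type u} [Field F] [Fintype F] {n m R r : ℕ} (hR : R ≤ min n m)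
    (hr : r < R) {t : ℕ} (ht : 2 ≤ t) :
    t + t * r ^ 2 * Real.logb 2 (Fintype.card F) ≤
      6144 * (randCC (1 / 3) (rankProblem F n m r R t) : ℝ) := by
  have hn : R ≤ n := hR.trans (min_le_left _ _)
  have hm : R ≤ m := hR.trans (min_le_right _ _)
  let ι : Matrix (Fin R) (Fin R) F → Matrix (Fin n) (Fin m) F := fun M =>
    coordInclusion F n R * M * (coordInclusion F m R)ᵀ
  have h := le_randCC_rank_vs_det hr (one_ne_zero (α := F)) (fun M => rankFn F n m r R (ι M)) (-1)
    (fun M hM => by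
      simp only [rankFn, ι]
      rw [rank_coordInclusion_mul F hn hm, if_pos hM])
    (fun M hM => by
      have hrank : M.rank = R := rank_of_det_ne (by rw [hM]; exact one_ne_zero)
      simp only [rankFn, ι]
      rw [rank_coordInclusion_mul F hn hm, if_neg (by omega), if_pos hrank, neg_neg]) ht
  refine h.trans ?_
  gcongr
  refine randCC_le_of_reduction (by norm_num) _ _ (fun _ => ι) fun y v hv => ?_
  rw [← hv]
  simp only [rankProblem, sumProblem, ι]
  rw [Matrix.mul_sum, Matrix.sum_mul]

theorem le_randCC_rankDetProblem {F : Type u} [Field F] [Fintype F] {n r : ℕ} (hr : r < n) {a : F}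
    (ha : a ≠ 0) {t : ℕ} (ht : 2 ≤ t) :
    t + t * r ^ 2 * Real.logb 2 (Fintype.card F) ≤
      6144 * (randCC (1 / 3) (rankDetProblem F n r a t) : ℝ) := by
  refine le_randCC_rank_vs_det hr ha (rankDetFn F n r a) (-1) (fun M hM => ?_) (fun M hM => ?_) ht
  · rw [rankDetFn, if_pos hM]
  · have hrank : M.rank = n := rank_of_det_ne (by rwa [hM])
    rw [rankDetFn, if_neg (by omega), if_pos hM, neg_neg]

/-- If one of the two values is zero, matrices of rank `n - 1` stand in for it and the
rank-versus-determinant bound applies; `n ≤ 2 * (n - 1)` costs a factor `4`. Otherwise the two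
full-rank orbits are compared directly. -/
theorem le_randCC_detProblem {F : Type u} [Field F] [Fintype F] {n : ℕ} (hn : 2 ≤ n) {a b : F}
    (hab : a ≠ b) {t : ℕ} (ht : 2 ≤ t) :
    t * n ^ 2 * Real.logb 2 (Fintype.card F) ≤
      24576 * (randCC (1 / 3) (detProblem F n a b t) : ℝ) := by
  have hdet : ∀ M : Matrix (Fin n) (Fin n) F, M.rank = n - 1 → M.det = 0 := fun M hM => by
    by_contra h
    have := rank_of_det_ne h
    omega
  have hlog : 0 ≤ Real.logb 2 (Fintype.card F) :=
    Real.logb_nonneg (by norm_num) (by exact_mod_cast Fintype.card_pos)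
  have hconv : t + t * ((n - 1 : ℕ) : ℝ) ^ 2 * Real.logb 2 (Fintype.card F) ≤
      6144 * (randCC (1 / 3) (detProblem F n a b t) : ℝ) →
      t * n ^ 2 * Real.logb 2 (Fintype.card F) ≤
        24576 * (randCC (1 / 3) (detProblem F n a b t) : ℝ) := fun h => by
    have h1 : (n : ℝ) ≤ 2 * (n - 1 : ℕ) := by exact_mod_cast (by omega : n ≤ 2 * (n - 1))
    have h2 : t * (n : ℝ) ^ 2 * Real.logb 2 (Fintype.card F) ≤
        t * (2 * ((n - 1 : ℕ) : ℝ)) ^ 2 * Real.logb 2 (Fintype.card F) := by gcongr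
    have h3 : (0 : ℝ) ≤ t := Nat.cast_nonneg t
    nlinarith
  by_cases ha : a = 0
  · subst ha
    refine hconv (le_randCC_rank_vs_det (by omega) hab.symm (detFn F n 0 b) (-1) (fun M hM => ?_)
      (fun M hM => ?_) ht)
    · rw [detFn, if_pos (hdet M hM)]
    · rw [detFn, if_neg (by rw [hM]; exact hab.symm), if_pos hM, neg_neg]
  · by_cases hb : b = 0
    · subst hb
      refine hconv (le_randCC_rank_vs_det (by omega) ha (detFn F n a 0) 1 (fun M hM => ?_)
        (fun M hM => ?_) ht)
      · rw [detFn, if_neg (by rw [hdet M hM]; exact hab.symm), if_pos (hdet M hM)]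
      · rw [detFn, if_pos hM]
    · refine (le_randCC_det_vs_det hn ha hb (detFn F n a b) (fun M hM => ?_) (fun M hM => ?_)
        ht).trans ?_
      · rw [detFn, if_pos hM]
      · rw [detFn, if_neg (by rw [hM]; exact hab.symm), if_pos hM]
      · change 768 * (randCC (1 / 3) (detProblem F n a b t) : ℝ) ≤ _
        gcongr
        norm_num

end Blackboard

theorem theorem1p12 :
    ∃ c : ℝ, 0 < c ∧ ∀ (F : Type u) [Field F] [Fintype F] (t : ℕ), 2 ≤ t →
      (∀ n m R r : ℕ, R ≤ min n m → r < R →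
        c * (t + t * r ^ 2 * Real.logb 2 (Fintype.card F)) ≤
          (Blackboard.randCC (1 / 3) (Blackboard.rankProblem F n m r R t) : ℝ)) ∧
      (∀ (a b : F) (n : ℕ), a ≠ b → 2 ≤ n →
        c * (t * n ^ 2 * Real.logb 2 (Fintype.card F)) ≤
          (Blackboard.randCC (1 / 3) (Blackboard.detProblem F n a b t) : ℝ)) ∧
      (∀ (a : F) (n r : ℕ), a ≠ 0 → r < n →
        c * (t + t * r ^ 2 * Real.logb 2 (Fintype.card F)) ≤
          (Blackboard.randCC (1 / 3) (Blackboard.rankDetProblem F n r a t) : ℝ)) := by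
  refine ⟨1 / 24576, by norm_num, fun F _ _ t ht => ⟨fun n m R r hR hr => ?_,
    fun a b n hab hn => ?_, fun a n r ha hr => ?_⟩⟩
  · have h := Blackboard.le_randCC_rankProblem (F := F) hR hr ht
    have h0 : (0 : ℝ) ≤ Blackboard.randCC (1 / 3) (Blackboard.rankProblem F n m r R t) :=
      Nat.cast_nonneg _
    linarith
  · have h := Blackboard.le_randCC_detProblem hn hab ht
    linarith
  · have h := Blackboard.le_randCC_rankDetProblem hr ha ht
    have h0 : (0 : ℝ) ≤ Blackboard.randCC (1 / 3) (Blackboard.rankDetProblem F n r a t) :=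
      Nat.cast_nonneg _
    linarith
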